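/- Let $\mathcal H$ be a complex Hilbert space (of arbitrary, finite or infinite, dimension). For non-negative bounded operators $\rho,\sigma$ on $\mathcal H$ and $\alpha\in[1/2,1)\cup(1,\infty)$ put $$ Q_\alpha(\rho,\sigma)=\operatorname{tr}\left(\sigma^{(1-\alpha)/(2\alpha)}\,\rho\,\sigma^{(1-\alpha)/(2\alpha)}\right)^{\alpha}\in[0,\infty]. $$ Here $\operatorname{tr}(T)^\alpha$ means $\operatorname{tr}(T^\alpha)$. For $\alpha>1$, where the exponent $-\beta=(1-\alpha)/(2\alpha)$ of $\sigma$ is negative, $\sigma^{-\beta}\rho\,\sigma^{-\beta}$ denotes the (unique, if it exists) non-negative bounded operator $X$ which vanishes on $\ker\sigma$ and satisfies $\sigma^{\beta}X\sigma^{\beta}=\rho$, and $Q_\alpha(\rho,\sigma)=\infty$ if there is no such $X$. In particular $Q_\alpha(\rho,\sigma)=\infty$ if $\ker\sigma\not\subset\ker\rho$; if $\dim\mathcal H<\infty$, then $X$ exists exactly when $\ker\sigma\subset\ker\rho$. Then the map $(\rho,\sigma)\mapsto Q_\alpha(\rho,\sigma)$ on pairs of non-negative bounded operators on $\mathcal H$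 is jointly concave for $1/2\le\alpha<1$ and jointly convex for $\alpha>1$. -/

import Mathlib

open scoped NNReal ENNReal InnerProductSpace

noncomputable section

namespace SandwichedRenyi

variable {H : Type*} [NormedAddCommGroup H] [InnerProductSpace ℂ H] [CompleteSpace H]

/-- The diagonal sum `∑ᵢ ⟪bᵢ, A bᵢ⟫ ∈ [0, ∞]` of a nonnegative operator in an orthonormal basis. -/
def diagSum {ι : Type*} (b : HilbertBasis ι ℂ H) (A : H →L[ℂ] H) : ℝ≥0∞ :=
  ∑' i, ENNReal.ofReal (⟪b i, A (b i)⟫_ℂ).re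

/-- The trace `tr A ∈ [0, ∞]` of a nonnegative bounded operator `A` on a Hilbert space (of any
dimension): its diagonal sum in an orthonormal basis. It is finite exactly if `A` is trace class,
and does not depend on the basis (`trace_eq_diagSum`). -/
def trace (A : H →L[ℂ] H) : ℝ≥0∞ :=
  diagSum (exists_hilbertBasis ℂ H).choose_spec.choose A

theorem tsum_sq_inner {H : Type*} [NormedAddCommGroup H] [InnerProductSpace ℂ H] {ι : Type*}
    (b : HilbertBasis ι ℂ H) (y : H) :
    ∑' i, ENNReal.ofReal (‖⟪b i, y⟫_ℂ‖ ^ 2) = ENNReal.ofReal (‖y‖ ^ 2) := by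
  have h := b.hasSum_inner_mul_inner y y
  have h2 : HasSum (fun i => ‖⟪b i, y⟫_ℂ‖ ^ 2) (‖y‖ ^ 2) := by
    have h3 := Complex.hasSum_re h
    have e : (⟪y, y⟫_ℂ).re = ‖y‖ ^ 2 := by
      rw [inner_self_eq_norm_sq_to_K]; norm_cast
    rw [e] at h3
    refine h3.congr_fun ?_
    intro i
    rw [← inner_conj_symm y (b i), ← Complex.normSq_eq_conj_mul_self, Complex.ofReal_re,
      Complex.normSq_eq_norm_sq]
  rw [← h2.tsum_eq, ENNReal.ofReal_tsum_of_nonneg (fun i => by positivity) h2.summable]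

/-- For a nonnegative operator the diagonal sum is the same in all orthonormal bases. -/
theorem diagSum_eq_diagSum {ι κ : Type*} (b : HilbertBasis ι ℂ H) (c : HilbertBasis κ ℂ H)
    {A : H →L[ℂ] H} (hA : A.IsPositive) : diagSum b A = diagSum c A := by
  have hA0 : (0 : H →L[ℂ] H) ≤ A := (ContinuousLinearMap.nonneg_iff_isPositive A).2 hA
  set S := CFC.sqrt A with hS
  have hSsa : IsSelfAdjoint S := (CFC.sqrt_nonneg A).isSelfAdjoint
  have hSS : S * S = A := CFC.sqrt_mul_sqrt_self A
  have hsym : ∀ x y : H, ⟪S x, y⟫_ℂ = ⟪x, S y⟫_ℂ := hSsa.isSymmetric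
  have hdiag : ∀ x : H, (⟪x, A x⟫_ℂ).re = ‖S x‖ ^ 2 := by
    intro x
    rw [← hSS, mul_apply_eq_comp, ← hsym, inner_self_eq_norm_sq_to_K]
    norm_cast
  unfold diagSum
  simp only [hdiag]
  simp only [← tsum_sq_inner c (S (b _))]
  rw [ENNReal.tsum_comm]
  refine tsum_congr fun j => ?_
  rw [← tsum_sq_inner b (S (c j))]
  refine tsum_congr fun i => ?_
  rw [← hsym, norm_inner_symm]

theorem trace_eq_diagSum {ι : Type*} (b : HilbertBasis ι ℂ H) {A : H →L[ℂ] H}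
    (hA : A.IsPositive) : trace A = diagSum b A :=
  diagSum_eq_diagSum _ b hA

/-- `X = σ^(-β) ρ σ^(-β)` for nonnegative bounded `ρ`, `σ` and `β > 0`, where `σ` need not be
invertible and `σ^(-β)` may be unbounded: `X` is the nonnegative bounded operator that vanishes on
`ker σ` and whose quadratic form on the range of `σ^β` is that of `σ^(-β) ρ σ^(-β)`, that is
`⟪σ^β φ, X σ^β φ⟫ = ⟪φ, ρ φ⟫` for all `φ`, or equivalently `σ^β X σ^β = ρ`. -/
def IsNegSandwich (β : ℝ) (ρ σ X : H →L[ℂ] H) : Prop :=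
  X.IsPositive ∧ (∀ x, σ x = 0 → X x = 0) ∧ σ ^ β * X * σ ^ β = ρ

theorem rpow_apply_eq_zero {σ : H →L[ℂ] H} (hσ : σ.IsPositive) {β : ℝ} (h0 : 0 < β) (h1 : β < 1)
    {x : H} (hx : (σ ^ β) x = 0) : σ x = 0 := by
  have hσ0 : (0 : H →L[ℂ] H) ≤ σ := (ContinuousLinearMap.nonneg_iff_isPositive σ).2 hσ
  have h : σ ^ (1 - β) * σ ^ β = σ := by
    lift β to ℝ≥0 using h0.le
    have h1' : β < 1 := by exact_mod_cast h1
    have h0' : 0 < β := by exact_mod_cast h0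
    have e : (1 - (β : ℝ)) = ((1 - β : ℝ≥0) : ℝ) := by
      rw [NNReal.coe_sub h1'.le, NNReal.coe_one]
    rw [e, ← CFC.nnrpow_eq_rpow h0', ← CFC.nnrpow_eq_rpow (tsub_pos_of_lt h1'),
      ← CFC.nnrpow_add (tsub_pos_of_lt h1') h0', tsub_add_cancel_of_le h1'.le, CFC.nnrpow_one σ]
  rw [← h, mul_apply_eq_comp, hx, map_zero]

/-- There is at most one `X = σ^(-β) ρ σ^(-β)`. -/
theorem IsNegSandwich.unique {β : ℝ} (h0 : 0 < β) (h1 : β < 1) {ρ σ X Y : H →L[ℂ] H}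
    (hσ : σ.IsPositive) (hX : IsNegSandwich β ρ σ X) (hY : IsNegSandwich β ρ σ Y) : X = Y := by
  obtain ⟨hX0, hXk, hXe⟩ := hX
  obtain ⟨hY0, hYk, hYe⟩ := hY
  have hD : IsSelfAdjoint (X - Y) := hX0.isSelfAdjoint.sub hY0.isSelfAdjoint
  have hS : IsSelfAdjoint (σ ^ β) := (CFC.rpow_nonneg (a := σ) (y := β)).isSelfAdjoint
  set D := X - Y with hDdef
  set S := σ ^ β with hSdef
  have hker : ∀ x, S x = 0 → D x = 0 := by
    intro x hx
    have hx' := rpow_apply_eq_zero hσ h0 h1 hx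
    simp [hDdef, hXk x hx', hYk x hx']
  have hDs : ∀ x y : H, ⟪D x, y⟫_ℂ = ⟪x, D y⟫_ℂ := hD.isSymmetric
  have hSs : ∀ x y : H, ⟪S x, y⟫_ℂ = ⟪x, S y⟫_ℂ := hS.isSymmetric
  have hSDS : ∀ x, S (D (S x)) = 0 := by
    intro x
    have : S * D * S = 0 := by rw [hDdef, mul_sub, sub_mul, hXe, hYe, sub_self]
    simpa [mul_apply_eq_comp] using congrArg (fun T : H →L[ℂ] H => T x) this
  have hDS : ∀ x, D (S x) = 0 := by
    intro x
    have h := hker _ (hSDS x)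
    rw [← inner_self_eq_zero (𝕜 := ℂ), hDs, h, inner_zero_right]
  have hSD : ∀ x, S (D x) = 0 := by
    intro x
    rw [← inner_self_eq_zero (𝕜 := ℂ), hSs, hDs, hDS, inner_zero_right]
  have hD0 : D = 0 := by
    ext x
    rw [_root_.zero_apply, ← inner_self_eq_zero (𝕜 := ℂ), hDs, hker _ (hSD x),
      inner_zero_right]
  exact sub_eq_zero.1 hD0

/-- For invertible `σ`, the operator `σ^(-β) ρ σ^(-β)` is the usual product. -/
theorem isNegSandwich_of_isUnit {β : ℝ} {ρ σ : H →L[ℂ] H} (hρ : ρ.IsPositive) (hσ : σ.IsPositive)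
    (hu : IsUnit σ) : IsNegSandwich β ρ σ (σ ^ (-β) * ρ * σ ^ (-β)) := by
  have hσ0 : (0 : H →L[ℂ] H) ≤ σ := (ContinuousLinearMap.nonneg_iff_isPositive σ).2 hσ
  have hρ0 : (0 : H →L[ℂ] H) ≤ ρ := (ContinuousLinearMap.nonneg_iff_isPositive ρ).2 hρ
  have hs : IsStrictlyPositive σ := ⟨hσ0, hu⟩
  have hS : IsSelfAdjoint (σ ^ (-β)) := (CFC.rpow_nonneg (a := σ) (y := -β)).isSelfAdjoint
  refine ⟨(ContinuousLinearMap.nonneg_iff_isPositive _).1 (hS.conjugate_nonneg hρ0), ?_, ?_⟩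
  · intro x hx
    obtain ⟨u, rfl⟩ := hu
    have : x = 0 := by
      have h : ((↑u⁻¹ : H →L[ℂ] H) * (u : H →L[ℂ] H)) x = 0 := by
        rw [mul_apply_eq_comp, hx, map_zero]
      rwa [Units.inv_mul] at h
    rw [this, map_zero]
  · calc σ ^ β * (σ ^ (-β) * ρ * σ ^ (-β)) * σ ^ β
        = (σ ^ β * σ ^ (-β)) * ρ * (σ ^ (-β) * σ ^ β) := by noncomm_ring
      _ = ρ := by rw [CFC.rpow_mul_rpow_neg β, CFC.rpow_neg_mul_rpow β, one_mul, mul_one]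

/-- In finite dimensions, where the real powers of `σ` are those on the orthogonal complement of
`ker σ` and zero on `ker σ`, the operator `σ^(-β) ρ σ^(-β)` is the usual product as soon as
`ker σ ⊆ ker ρ`. -/
theorem isNegSandwich_of_ker_le [FiniteDimensional ℂ H] {β : ℝ} (h0 : 0 < β) {ρ σ : H →L[ℂ] H}
    (hρ : ρ.IsPositive) (hσ : σ.IsPositive) (hker : ∀ x, σ x = 0 → ρ x = 0) :
    IsNegSandwich β ρ σ (σ ^ (-β) * ρ * σ ^ (-β)) := by
  have hσ0 : (0 : H →L[ℂ] H) ≤ σ := (ContinuousLinearMap.nonneg_iff_isPositive σ).2 hσ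
  have hρ0 : (0 : H →L[ℂ] H) ≤ ρ := (ContinuousLinearMap.nonneg_iff_isPositive ρ).2 hρ
  have hS : IsSelfAdjoint (σ ^ (-β)) := (CFC.rpow_nonneg (a := σ) (y := -β)).isSelfAdjoint
  have hfin : (spectrum ℝ≥0 σ).Finite := by
    have h1 : (spectrum ℂ σ).Finite := by
      rw [← AlgEquiv.spectrum_eq (Module.End.toContinuousLinearMap H).symm σ]
      exact Module.End.finite_spectrum _
    rw [← spectrum.preimage_algebraMap ℂ]
    refine h1.preimage (Function.Injective.injOn fun x y h => ?_)
    exact NNReal.coe_injective (Complex.ofReal_injective h)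
  have hc : ∀ f : ℝ≥0 → ℝ≥0, ContinuousOn f (spectrum ℝ≥0 σ) := fun f => hfin.continuousOn f
  have hid : cfc (fun x : ℝ≥0 => x) σ = σ := cfc_id' ℝ≥0 σ
  have hfac : σ ^ (-β) = σ ^ (-β - 1) * σ := by
    have h : cfc (fun x : ℝ≥0 => x ^ (-β - 1) * x) σ = σ ^ (-β - 1) * σ := by
      rw [cfc_mul _ _ σ (hc _) (hc _), hid]
      rfl
    rw [← h]
    refine cfc_congr fun x _ => ?_
    rcases eq_or_ne x 0 with rfl | hx
    · simp [NNReal.zero_rpow (neg_ne_zero.2 h0.ne')]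
    · simp [NNReal.rpow_sub_one hx, hx]
  have hPσ : σ * (σ ^ (-β) * σ ^ β) = σ := by
    have h : cfc (fun x : ℝ≥0 => x * (x ^ (-β) * x ^ β)) σ = σ * (σ ^ (-β) * σ ^ β) := by
      rw [cfc_mul _ _ σ (hc _) (hc _), cfc_mul _ _ σ (hc _) (hc _), hid]
      rfl
    rw [← h]
    conv_rhs => rw [← hid]
    refine cfc_congr fun x _ => ?_
    rcases eq_or_ne x 0 with rfl | hx
    · simp
    · simp [← NNReal.rpow_add hx]
  have hcomm : σ ^ β * σ ^ (-β) = σ ^ (-β) * σ ^ β := cfc_commute_cfc _ _ σ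
  have hρP : ρ * (σ ^ (-β) * σ ^ β) = ρ := by
    ext x
    have h : σ (x - (σ ^ (-β) * σ ^ β) x) = 0 := by
      rw [map_sub, ← mul_apply_eq_comp, hPσ, sub_self]
    have h' := hker _ h
    rw [map_sub, sub_eq_zero] at h'
    rw [mul_apply_eq_comp, ← h']
  have hSβ : IsSelfAdjoint (σ ^ β) := (CFC.rpow_nonneg (a := σ) (y := β)).isSelfAdjoint
  have hPρ : σ ^ β * σ ^ (-β) * ρ = ρ := by
    have h := congrArg star hρP
    rwa [star_mul, star_mul, hS.star_eq, hSβ.star_eq, hρ.isSelfAdjoint.star_eq] at h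
  refine ⟨(ContinuousLinearMap.nonneg_iff_isPositive _).1 (hS.conjugate_nonneg hρ0), ?_, ?_⟩
  · intro x hx
    have h : (σ ^ (-β)) x = 0 := by rw [hfac, mul_apply_eq_comp, hx, map_zero]
    rw [mul_apply_eq_comp, h, map_zero]
  · calc σ ^ β * (σ ^ (-β) * ρ * σ ^ (-β)) * σ ^ β
        = (σ ^ β * σ ^ (-β) * ρ) * (σ ^ (-β) * σ ^ β) := by noncomm_ring
      _ = ρ := by rw [hPρ, hρP]

/-- `tr (σ^((1-α)/(2α)) ρ σ^((1-α)/(2α)))^α ∈ [0, ∞]` for nonnegative bounded operators `ρ`, `σ`.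
For `α > 1` the exponent of `σ` is negative, and the value is `∞` if there is no bounded operator
`σ^((1-α)/(2α)) ρ σ^((1-α)/(2α))`; in particular if `ker σ` is not contained in `ker ρ`.
The infimum runs over at most one operator (`IsNegSandwich.unique`). -/
def sandwichedTrace (α : ℝ) (ρ σ : H →L[ℂ] H) : ℝ≥0∞ :=
  if α ≤ 1 then trace ((σ ^ ((1 - α) / (2 * α)) * ρ * σ ^ ((1 - α) / (2 * α))) ^ α)
  else ⨅ (X : H →L[ℂ] H) (_ : IsNegSandwich ((α - 1) / (2 * α)) ρ σ X), trace (X ^ α)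

end SandwichedRenyi

end

/-!
The functional `Q(ρ, σ) = tr (σ^((1-α)/(2α)) ρ σ^((1-α)/(2α)))^α` is positively homogeneous of
degree one, so that joint concavity (convexity) amounts to superadditivity (subadditivity). Put
`p = |1 - α| / α ∈ (0, 1]`. Both cases rest on a variational formula with test operators `L` of
finite rank and on Epstein's theorem (`sum_norm_rpow_superadditive`) that
`σ ↦ tr (L* σ^p L)^(1/p)` is superadditive.

Epstein's theorem follows from Lieb's (`sum_rpow_mul_re_inner_rpow_superadditive`), the joint
concavity of `(A, Y) ↦ tr (L* A^p L Y^(1-p))`, since by Young's inequality `tr (L* A^p L)^(1/p)` is the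
maximum of `p⁻¹ tr (L* A^p L Y^(1-p)) - (p⁻¹ - 1) tr Y` over `Y ≥ 0`. Lieb's theorem is obtained from
the integral representation of `x ↦ x^p`: the perspectives `y f_t(A / y)` of its integrands are
parallel sums, and their quadratic forms are minima of expressions linear in `A` and `y`
(`isLeast_perspective`).

For `α > 1`, `Q` is the supremum over `L` of `α tr (L* ρ L) - (α - 1) tr (L* σ^p L)^(1/p)`. Here `≤` is
the trace Young inequality (`sum_re_inner_le_trace_rpow`), and the supremum is approached on the
finite dimensional subspaces of `range σ^(p/2)` (`trace_rpow_le_add`). The operator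
`X = σ^(-p/2) ρ σ^(-p/2)` for the sum of two pairs exists by Douglas' factorization
(`exists_isNegSandwich`), because `x ↦ x^p` is operator monotone.

For `α < 1`, `Q` is an infimum, by the Hölder–Young inequality
`tr |G D|^(2α) ≤ α tr |D|^2 + (1 - α) tr |G|^(2/p)` (`sum_norm_comp_rpow_le`) with
`σ^(p/2) ρ^(1/2) = G D`, where `tr |G|^(2/p)` is again an expression as in Epstein's theorem
(`sum_norm_rpow_add_le`). It is applied to the finite rank truncations `ρ^(1/2) P ρ^(1/2) ≤ ρ`.

In both cases the passage from finite rank to general operators uses that `T ↦ tr T^s` is lower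
semicontinuous for bounded strong convergence (`trace_rpow_le_of_tendsto`). Traces over the finite
dimensional test spaces are written as sums over eigenbases (`IsSingularBasis`).
-/

open Filter Topology

namespace SandwichedRenyi

variable {H : Type*} [NormedAddCommGroup H] [InnerProductSpace ℂ H]

/-! ### Real powers of nonnegative operators -/

theorem nonneg_of_isPositive {A : H →L[ℂ] H} (hA : A.IsPositive) : (0 : H →L[ℂ] H) ≤ A :=
  (ContinuousLinearMap.nonneg_iff_isPositive A).2 hA

theorem inner_self_eq_ofReal (x : H) : ⟪x, x⟫_ℂ = ((‖x‖ ^ 2 : ℝ) : ℂ) := by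
  rw [inner_self_eq_norm_sq_to_K]; norm_cast

theorem re_inner_self_eq (x : H) : (⟪x, x⟫_ℂ).re = ‖x‖ ^ 2 := by
  rw [inner_self_eq_ofReal, Complex.ofReal_re]

theorem re_inner_nonneg {A : H →L[ℂ] H} (hA : A.IsPositive) (x : H) :
    0 ≤ (⟪x, A x⟫_ℂ).re := by
  have h := hA.re_inner_nonneg_right x
  exact h

theorem re_inner_mono {A B : H →L[ℂ] H} (h : A ≤ B) (x : H) :
    (⟪x, A x⟫_ℂ).re ≤ (⟪x, B x⟫_ℂ).re := by
  have h2 := re_inner_nonneg ((ContinuousLinearMap.le_def A B).1 h) x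
  simp only [sub_apply, inner_sub_right, Complex.sub_re] at h2
  linarith

theorem aeval_apply_of_apply_eq_smul {A : H →L[ℂ] H} {t : ℝ} {x : H} (hx : A x = (t : ℂ) • x)
    (q : Polynomial ℝ) : (Polynomial.aeval A q) x = ((q.eval t : ℝ) : ℂ) • x := by
  induction q using Polynomial.induction_on' with
  | add p q hp hq => simp [hp, hq, add_smul]
  | monomial n c =>
    have h : ∀ n : ℕ, (A ^ n) x = ((t : ℂ) ^ n) • x := by
      intro n
      induction n with
      | zero => simp
      | succ n ih => rw [pow_succ, mul_apply_eq_comp, hx, map_smul, ih, smul_smul, pow_succ,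
          mul_comm]
    simp [Polynomial.aeval_monomial, h, Algebra.algebraMap_eq_smul_one, ← Complex.coe_smul, smul_smul]

variable [CompleteSpace H]

theorem inner_rpow_left (A : H →L[ℂ] H) (s : ℝ) (x y : H) :
    ⟪(A ^ s) x, y⟫_ℂ = ⟪x, (A ^ s) y⟫_ℂ :=
  (CFC.rpow_nonneg (a := A) (y := s)).isSelfAdjoint.isSymmetric x y

theorem isPositive_rpow (A : H →L[ℂ] H) (s : ℝ) : (A ^ s).IsPositive :=
  (ContinuousLinearMap.nonneg_iff_isPositive _).1 CFC.rpow_nonneg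

theorem rpow_add_of_pos (A : H →L[ℂ] H) {s t : ℝ} (hs : 0 < s) (ht : 0 < t) :
    A ^ (s + t) = A ^ s * A ^ t := by
  lift s to ℝ≥0 using hs.le
  lift t to ℝ≥0 using ht.le
  have hs' : 0 < s := by exact_mod_cast hs
  have ht' : 0 < t := by exact_mod_cast ht
  rw [← NNReal.coe_add, ← CFC.nnrpow_eq_rpow hs', ← CFC.nnrpow_eq_rpow ht',
    ← CFC.nnrpow_eq_rpow (add_pos hs' ht'), CFC.nnrpow_add hs' ht']

theorem rpow_half_mul_self {ρ : H →L[ℂ] H} (hρ : ρ.IsPositive) :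
    ρ ^ (1 / 2 : ℝ) * ρ ^ (1 / 2 : ℝ) = ρ := by
  rw [← rpow_add_of_pos ρ (by norm_num) (by norm_num), add_halves,
    CFC.rpow_one ρ (nonneg_of_isPositive hρ)]

theorem inner_rpow_half {ρ : H →L[ℂ] H} (hρ : ρ.IsPositive) (x y : H) :
    ⟪(ρ ^ (1 / 2 : ℝ)) x, (ρ ^ (1 / 2 : ℝ)) y⟫_ℂ = ⟪x, ρ y⟫_ℂ := by
  rw [inner_rpow_left, ← mul_apply_eq_comp, rpow_half_mul_self hρ]

theorem norm_sq_rpow_apply (A : H →L[ℂ] H) {s : ℝ} (hs : 0 < s) (x : H) :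
    ‖(A ^ s) x‖ ^ 2 = (⟪x, (A ^ (2 * s)) x⟫_ℂ).re := by
  rw [two_mul, rpow_add_of_pos A hs hs, mul_apply_eq_comp, ← inner_rpow_left,
    re_inner_self_eq]

theorem spectrum_subset_Icc {A : H →L[ℂ] H} (hA : A.IsPositive) {C : ℝ} (hC : ‖A‖ ≤ C) :
    spectrum ℝ A ⊆ Set.Icc 0 C := by
  intro x hx
  have hA0 := nonneg_of_isPositive hA
  refine ⟨spectrum_nonneg_of_nonneg hA0 hx, ?_⟩
  rcases subsingleton_or_nontrivial H with hH | hH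
  · simp at hx
  have := spectrum.norm_le_norm_of_mem hx
  exact ((le_abs_self x).trans this).trans hC

/-- A real power is uniformly approximated by polynomials, at the level of operators: the same
polynomial serves for all nonnegative operators of norm at most `C`. -/
theorem exists_polynomial_near_rpow {s : ℝ} (hs : 0 < s) (C : ℝ) {ε : ℝ} (hε : 0 < ε) :
    ∃ q : Polynomial ℝ, (∀ x ∈ Set.Icc 0 C, |q.eval x - x ^ s| ≤ ε) ∧
      ∀ A : H →L[ℂ] H, A.IsPositive → ‖A‖ ≤ C → ‖Polynomial.aeval A q - A ^ s‖ ≤ ε := by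
  obtain ⟨q, hq⟩ := exists_polynomial_near_of_continuousOn 0 C (fun x => x ^ s)
    (Real.continuous_rpow_const hs.le).continuousOn ε hε
  refine ⟨q, fun x hx => (hq x hx).le, fun A hA hAC => ?_⟩
  have hA0 := nonneg_of_isPositive hA
  rw [CFC.rpow_eq_cfc_real hA0, ← cfc_polynomial q A hA.isSelfAdjoint,
    ← cfc_sub _ _ A (by fun_prop) (Real.continuous_rpow_const hs.le).continuousOn]
  refine norm_cfc_le hε.le fun x hx => ?_
  exact (hq x (spectrum_subset_Icc hA hAC hx)).le

/-- Real powers act on eigenvectors by the corresponding power of the eigenvalue. -/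
theorem rpow_apply_of_apply_eq_smul {A : H →L[ℂ] H} (hA : A.IsPositive) {s : ℝ} (hs : 0 < s)
    {t : ℝ} (ht : 0 ≤ t) {x : H} (hx : A x = (t : ℂ) • x) :
    (A ^ s) x = ((t ^ s : ℝ) : ℂ) • x := by
  rw [← sub_eq_zero, ← norm_eq_zero]
  refine le_antisymm (le_of_forall_pos_le_add fun ε hε => ?_) (norm_nonneg _)
  have hd : 0 < ε / (2 * ‖x‖ + 1) := by positivity
  obtain ⟨q, hq1, hq2⟩ := exists_polynomial_near_rpow (H := H) hs (max t ‖A‖) hd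
  have h1 := hq1 t ⟨ht, le_max_left _ _⟩
  have h2 := hq2 A hA (le_max_right _ _)
  have h3 : (A ^ s) x - ((t ^ s : ℝ) : ℂ) • x
      = ((q.eval t - t ^ s : ℝ) : ℂ) • x - (Polynomial.aeval A q - A ^ s) x := by
    rw [sub_apply, aeval_apply_of_apply_eq_smul hx, Complex.ofReal_sub, sub_smul]
    abel
  rw [h3]
  calc _ ≤ ‖((q.eval t - t ^ s : ℝ) : ℂ) • x‖ + ‖(Polynomial.aeval A q - A ^ s) x‖ :=
        norm_sub_le _ _
    _ ≤ ε / (2 * ‖x‖ + 1) * ‖x‖ + ε / (2 * ‖x‖ + 1) * ‖x‖ := by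
        gcongr
        · rw [norm_smul, Complex.norm_real]
          gcongr
          exact h1
        · exact (ContinuousLinearMap.le_opNorm _ _).trans (by gcongr)
    _ ≤ 0 + ε := by
        rw [zero_add, ← mul_add, div_mul_eq_mul_div, div_le_iff₀ (by positivity)]
        nlinarith

/-- Real powers are continuous for the strong operator topology on bounded sets of nonnegative
operators. -/
theorem tendsto_rpow_apply {ι : Type*} {l : Filter ι} {T : ι → H →L[ℂ] H} {A : H →L[ℂ] H} {C : ℝ}
    (hT : ∀ i, (T i).IsPositive) (hA : A.IsPositive) (hC : ∀ i, ‖T i‖ ≤ C)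
    (h : ∀ x, Tendsto (fun i => T i x) l (𝓝 (A x))) {s : ℝ} (hs : 0 < s) (x : H) :
    Tendsto (fun i => (T i ^ s) x) l (𝓝 ((A ^ s) x)) := by
  have hpow : ∀ (n : ℕ) (x : H), Tendsto (fun i => (T i ^ n) x) l (𝓝 ((A ^ n) x)) := by
    intro n
    induction n with
    | zero => intro x; simpa using tendsto_const_nhds
    | succ n ih =>
      intro x
      -- `Tᵢ (Tᵢⁿ x) - A (Aⁿ x) = Tᵢ (Tᵢⁿ x - Aⁿ x) + (Tᵢ - A) (Aⁿ x)`, where `‖Tᵢ‖ ≤ C`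
      have h1 : Tendsto (fun i => T i ((T i ^ n) x - (A ^ n) x)) l (𝓝 0) := by
        have h0 : Tendsto (fun i => C * ‖(T i ^ n) x - (A ^ n) x‖) l (𝓝 0) := by
          have := (tendsto_iff_norm_sub_tendsto_zero.1 (ih x)).const_mul C
          simpa using this
        refine squeeze_zero_norm (fun i => ?_) h0
        exact (ContinuousLinearMap.le_opNorm _ _).trans (by gcongr; exact hC i)
      have h2 := h1.add (h ((A ^ n) x))
      simp only [map_sub, sub_add_cancel, zero_add] at h2
      simpa only [pow_succ', mul_apply_eq_comp] using h2
  have hpoly : ∀ (q : Polynomial ℝ) (x : H),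
      Tendsto (fun i => (Polynomial.aeval (T i) q) x) l (𝓝 ((Polynomial.aeval A q) x)) := by
    intro q
    induction q using Polynomial.induction_on' with
    | add p q hp hq => intro x; simpa using (hp x).add (hq x)
    | monomial n c =>
      intro x
      simpa [Polynomial.aeval_monomial, Algebra.algebraMap_eq_smul_one] using
        (hpow n x).const_smul c
  rw [Metric.tendsto_nhds]
  intro ε hε
  have hd : 0 < ε / (4 * (‖x‖ + 1)) := by positivity
  obtain ⟨q, -, hq2⟩ := exists_polynomial_near_rpow (H := H) hs (max C ‖A‖) hd
  filter_upwards [Metric.tendsto_nhds.1 (hpoly q x) (ε / 2) (half_pos hε)] with i hi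
  have hb : ∀ B : H →L[ℂ] H, B.IsPositive → ‖B‖ ≤ max C ‖A‖ →
      dist ((Polynomial.aeval B q) x) ((B ^ s) x) < ε / 4 := by
    intro B hB hBC
    rw [dist_eq_norm, ← sub_apply]
    refine (ContinuousLinearMap.le_opNorm _ _).trans_lt ?_
    refine (mul_le_mul_of_nonneg_right (hq2 B hB hBC) (norm_nonneg x)).trans_lt ?_
    rw [div_mul_eq_mul_div, div_lt_div_iff₀ (by positivity) (by norm_num)]
    nlinarith
  have h1 := hb (T i) (hT i) ((hC i).trans (le_max_left _ _))
  have h2 := hb A hA (le_max_right _ _)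
  rw [dist_comm] at h1
  linarith [dist_triangle4 ((T i ^ s) x) ((Polynomial.aeval (T i) q) x)
    ((Polynomial.aeval A q) x) ((A ^ s) x)]

/-- Young's inequality `m X ≤ X^α / α + m^α' / α'`, as an inequality of quadratic forms. -/
theorem mul_re_inner_le_rpow {X : H →L[ℂ] H} (hX : X.IsPositive) {a b m : ℝ}
    (hab : a.HolderConjugate b) (hm : 0 ≤ m) (x : H) :
    m * (⟪x, X x⟫_ℂ).re ≤ (⟪x, (X ^ a) x⟫_ℂ).re / a + m ^ b / b * ‖x‖ ^ 2 := by
  have hX0 := nonneg_of_isPositive hX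
  have hca : ContinuousOn (fun t : ℝ => t ^ a) (spectrum ℝ X) :=
    (Real.continuous_rpow_const hab.nonneg).continuousOn
  have h : cfc (fun t : ℝ => m * t) X ≤ cfc (fun t : ℝ => a⁻¹ * t ^ a + m ^ b / b) X := by
    refine cfc_mono (fun t ht => ?_) (by fun_prop) ((hca.const_mul _).add continuousOn_const)
    have ht0 : 0 ≤ t := spectrum_nonneg_of_nonneg hX0 ht
    have := Real.young_inequality_of_nonneg ht0 hm hab
    rw [mul_comm m, inv_mul_eq_div]
    exact this
  rw [cfc_const_mul_id m X hX.isSelfAdjoint,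
    cfc_add_const _ _ X (hca.const_mul _) hX.isSelfAdjoint, cfc_const_mul _ _ X hca,
    ← CFC.rpow_eq_cfc_real hX0] at h
  have h2 := re_inner_mono h x
  simp only [smul_apply, add_apply, Algebra.algebraMap_eq_smul_one, inner_add_right,
    one_apply_eq_self, inner_smul_right_eq_smul, Complex.add_re, Complex.smul_re, smul_eq_mul,
    re_inner_self_eq] at h2
  rw [div_eq_inv_mul]
  exact h2

/-! ### The trace of a power -/

section Trace

theorem sum_eq_sum_subtype_ne_zero {ι E G : Type*} [Fintype ι] [AddCommMonoid E] [Zero G]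
    {g : ι → G} [DecidablePred fun i => g i ≠ 0] {F : ι → E} (hF : ∀ i, g i = 0 → F i = 0) :
    ∑ i, F i = ∑ i : {i // g i ≠ 0}, F i := by
  rw [← Finset.sum_subtype (Finset.univ.filter fun i => g i ≠ 0) (by simp) F]
  exact (Finset.sum_filter_of_ne (p := fun i => g i ≠ 0) fun i _ hi h0 => hi (hF i h0)).symm

variable {H : Type*} [NormedAddCommGroup H] [InnerProductSpace ℂ H]

theorem orthonormal_normalize {ι : Type*} {g : ι → H} (hg : Pairwise fun i j => ⟪g i, g j⟫_ℂ = 0) :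
    Orthonormal ℂ (fun i : {i // g i ≠ 0} => ((‖g i‖⁻¹ : ℝ) : ℂ) • g i) := by
  refine ⟨fun i => ?_, fun i j hij => ?_⟩
  · rw [norm_smul, Complex.norm_real, norm_inv, norm_norm,
      inv_mul_cancel₀ (norm_ne_zero_iff.2 i.2)]
  · simp only
    rw [inner_smul_left, inner_smul_right, hg (fun h => hij (Subtype.ext h))]
    simp

theorem eq_norm_smul_normalize (x : H) : x = (‖x‖ : ℂ) • ((‖x‖⁻¹ : ℝ) : ℂ) • x := by
  rcases eq_or_ne x 0 with rfl | hx
  · simp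
  · have : (‖x‖ : ℂ) ≠ 0 := by exact_mod_cast norm_ne_zero_iff.2 hx
    simp [smul_smul, this]

theorem diagSum_mono {ι : Type*} (b : HilbertBasis ι ℂ H) {A B : H →L[ℂ] H} (h : A ≤ B) :
    diagSum b A ≤ diagSum b B :=
  ENNReal.tsum_le_tsum fun i => ENNReal.ofReal_le_ofReal (re_inner_mono h (b i))

variable [CompleteSpace H]

theorem trace_mono {A B : H →L[ℂ] H} (h : A ≤ B) : trace A ≤ trace B :=
  diagSum_mono _ h

theorem sum_le_trace {ι : Type*} {s : Finset ι} {h : ι → H} (hh : Orthonormal ℂ h)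
    {A : H →L[ℂ] H} (hA : A.IsPositive) :
    ∑ i ∈ s, ENNReal.ofReal (⟪h i, A (h i)⟫_ℂ).re ≤ trace A := by
  obtain ⟨w, b, hw, hb⟩ := hh.toSubtypeRange.exists_hilbertBasis_extension
  rw [trace_eq_diagSum b hA]
  have hg : Function.Injective (fun i => (⟨h i, hw ⟨i, rfl⟩⟩ : w)) := fun i j hij =>
    hh.linearIndependent.injective (congrArg Subtype.val hij)
  calc _ = ∑ i ∈ s, ENNReal.ofReal (⟪b ⟨h i, hw ⟨i, rfl⟩⟩, A (b ⟨h i, hw ⟨i, rfl⟩⟩)⟫_ℂ).re := by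
        simp [hb]
    _ ≤ ∑' i, ENNReal.ofReal (⟪b ⟨h i, hw ⟨i, rfl⟩⟩, A (b ⟨h i, hw ⟨i, rfl⟩⟩)⟫_ℂ).re :=
        ENNReal.sum_le_tsum s
    _ ≤ _ := ENNReal.tsum_comp_le_tsum_of_injective hg
        (fun k => ENNReal.ofReal (⟪b k, A (b k)⟫_ℂ).re)

/-- The trace of a power of a nonnegative finite rank operator, diagonal in the orthonormal
system `h`. -/
theorem trace_rpow_eq_sum {ι : Type*} [Fintype ι] {h : ι → H} (hh : Orthonormal ℂ h)
    {T : H →L[ℂ] H} (hT : T.IsPositive) {t : ι → ℝ} (ht : ∀ i, 0 ≤ t i)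
    (hTh : ∀ i, T (h i) = (t i : ℂ) • h i) (hT0 : ∀ x, (∀ i, ⟪h i, x⟫_ℂ = 0) → T x = 0)
    {s : ℝ} (hs : 0 < s) : trace (T ^ s) = ∑ i, ENNReal.ofReal (t i ^ s) := by
  obtain ⟨w, b, hw, hb⟩ := hh.toSubtypeRange.exists_hilbertBasis_extension
  rw [trace_eq_diagSum b (isPositive_rpow T s), diagSum]
  have hg : Function.Injective (fun i => (⟨h i, hw ⟨i, rfl⟩⟩ : w)) := fun i j hij =>
    hh.linearIndependent.injective (congrArg Subtype.val hij)
  have hbo : ∀ i j : w, i ≠ j → ⟪b i, b j⟫_ℂ = 0 := fun i j hij => b.orthonormal.2 hij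
  rw [← hg.tsum_eq (f := fun k => ENNReal.ofReal (⟪b k, (T ^ s) (b k)⟫_ℂ).re), tsum_fintype]
  · refine Finset.sum_congr rfl fun i _ => ?_
    have e : ⟪h i, h i⟫_ℂ = 1 := by
      rw [inner_self_eq_norm_sq_to_K, hh.1 i]; simp
    simp only [hb]
    rw [rpow_apply_of_apply_eq_smul hT hs (ht i) (hTh i), inner_smul_right, e, mul_one,
      Complex.ofReal_re]
  · intro k hk
    by_contra hk'
    refine hk ?_
    have h0 : T (b k) = ((0 : ℝ) : ℂ) • b k := by
      rw [Complex.ofReal_zero, zero_smul]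
      refine hT0 _ fun i => ?_
      have := hbo ⟨h i, hw ⟨i, rfl⟩⟩ k (fun hik => hk' ⟨i, hik⟩)
      simpa only [hb] using this
    simp only
    rw [rpow_apply_of_apply_eq_smul hT hs le_rfl h0, Real.zero_rpow hs.ne']
    simp

/-- The trace of a power of `T = ∑ᵢ |gᵢ⟩⟨gᵢ|` for an orthogonal system `g`. -/
theorem trace_rpow_eq_sum_norm {ι : Type*} [Fintype ι] {g : ι → H}
    (hg : Pairwise fun i j => ⟪g i, g j⟫_ℂ = 0) {T : H →L[ℂ] H} (hT : T.IsPositive)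
    (hTg : ∀ x, T x = ∑ i, ⟪g i, x⟫_ℂ • g i) {s : ℝ} (hs : 0 < s) :
    trace (T ^ s) = ENNReal.ofReal (∑ i, (‖g i‖ ^ 2) ^ s) := by
  classical
  let κ := {i // g i ≠ 0}
  have hTgj : ∀ j, T (g j) = ((‖g j‖ ^ 2 : ℝ) : ℂ) • g j := by
    intro j
    rw [hTg, Finset.sum_eq_single j (fun i _ hij => by rw [hg hij, zero_smul])
      (fun h => absurd (Finset.mem_univ j) h), inner_self_eq_ofReal]
  have hh := orthonormal_normalize hg
  rw [trace_rpow_eq_sum hh hT (t := fun i : κ => ‖g i‖ ^ 2) (fun i => by positivity) ?_ ?_ hs,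
    ENNReal.ofReal_sum_of_nonneg (fun i _ => by positivity)]
  · refine (sum_eq_sum_subtype_ne_zero (g := g)
      (F := fun i => ENNReal.ofReal ((‖g i‖ ^ 2) ^ s)) fun i hi => ?_).symm
    simp [hi, Real.zero_rpow hs.ne']
  · intro i
    rw [map_smul, hTgj, smul_comm]
  · intro x hx
    rw [hTg]
    refine Finset.sum_eq_zero fun i _ => ?_
    by_cases hi : g i = 0
    · simp [hi]
    · have := hx ⟨i, hi⟩
      rw [inner_smul_left, mul_eq_zero] at this
      rcases this with h | h
      · exact absurd h (by simpa using hi)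
      · rw [h, zero_smul]

/-- The trace of a power is lower semicontinuous for bounded strong convergence. -/
theorem trace_rpow_le_of_tendsto {ι : Type*} {l : Filter ι} [l.NeBot] {T : ι → H →L[ℂ] H}
    {A : H →L[ℂ] H} {C : ℝ} (hT : ∀ i, (T i).IsPositive) (hA : A.IsPositive)
    (hC : ∀ i, ‖T i‖ ≤ C) (h : ∀ x, Tendsto (fun i => T i x) l (𝓝 (A x))) {s : ℝ} (hs : 0 < s)
    {B : ℝ≥0∞} (hB : ∀ i, trace (T i ^ s) ≤ B) : trace (A ^ s) ≤ B := by
  rw [trace, diagSum, ENNReal.tsum_eq_iSup_sum]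
  refine iSup_le fun F => ?_
  refine le_of_tendsto' (x := l) (tendsto_finsetSum F fun i _ => ENNReal.tendsto_ofReal
    ((Complex.continuous_re.tendsto _).comp
      (tendsto_const_nhds.inner (tendsto_rpow_apply hT hA hC h hs _)))) fun i => ?_
  exact (sum_le_trace (HilbertBasis.orthonormal _) (isPositive_rpow _ _)).trans (hB i)

end Trace

/-! ### Singular bases -/

section SingularBasis

variable {H W : Type*} [NormedAddCommGroup H] [InnerProductSpace ℂ H]
  [NormedAddCommGroup W] [InnerProductSpace ℂ W]

/-- An orthonormal basis `e` that `M` maps to an orthogonal system, that is, an eigenbasis of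
`M* M`. The eigenvalues, the squared singular values of `M`, are the numbers `‖M eᵢ‖ ^ 2`, so
that `tr (M* M) ^ r = ∑ᵢ (‖M eᵢ‖ ^ 2) ^ r`. -/
def IsSingularBasis {ι : Type*} [Fintype ι] (M : W →ₗ[ℂ] H) (e : OrthonormalBasis ι ℂ W) : Prop :=
  Pairwise fun i j => ⟪M (e i), M (e j)⟫_ℂ = 0

theorem exists_isSingularBasis [CompleteSpace H] [FiniteDimensional ℂ W] (M : W →ₗ[ℂ] H) :
    ∃ e : OrthonormalBasis (Fin (Module.finrank ℂ W)) ℂ W, IsSingularBasis M e := by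
  have := FiniteDimensional.complete ℂ W
  let N : W →L[ℂ] H := LinearMap.toContinuousLinearMap M
  let T : W →L[ℂ] W := N.adjoint ∘L N
  have hT : (T : W →ₗ[ℂ] W).IsSymmetric := by
    intro x y
    simp [T, ContinuousLinearMap.adjoint_inner_left, ContinuousLinearMap.adjoint_inner_right]
  refine ⟨hT.eigenvectorBasis rfl, fun i j hij => ?_⟩
  have h1 : ⟪M (hT.eigenvectorBasis rfl i), M (hT.eigenvectorBasis rfl j)⟫_ℂ
      = ⟪hT.eigenvectorBasis rfl i, (T : W →ₗ[ℂ] W) (hT.eigenvectorBasis rfl j)⟫_ℂ := by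
    change _ = ⟪hT.eigenvectorBasis rfl i, N.adjoint (N (hT.eigenvectorBasis rfl j))⟫_ℂ
    rw [ContinuousLinearMap.adjoint_inner_right]
    rfl
  simp only
  rw [h1, hT.apply_eigenvectorBasis, inner_smul_right,
    (hT.eigenvectorBasis rfl).orthonormal.2 hij, mul_zero]

theorem sum_inner_apply_eq {ι κ : Type*} [Fintype ι] [Fintype κ] (e : OrthonormalBasis ι ℂ W)
    (f : OrthonormalBasis κ ℂ W) (P Q : W →ₗ[ℂ] H) :
    ∑ i, ⟪P (e i), Q (e i)⟫_ℂ = ∑ j, ⟪P (f j), Q (f j)⟫_ℂ := by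
  have h1 : ∀ i, ⟪P (e i), Q (e i)⟫_ℂ = ∑ j, ⟪P (⟪e i, f j⟫_ℂ • e i), Q (f j)⟫_ℂ := by
    intro i
    have hQ : Q (e i) = ∑ j, ⟪f j, e i⟫_ℂ • Q (f j) := by
      conv_lhs => rw [← f.sum_repr' (e i), map_sum]
      simp_rw [map_smul]
    rw [hQ, inner_sum]
    refine Finset.sum_congr rfl fun j _ => ?_
    rw [inner_smul_right, map_smul, inner_smul_left, inner_conj_symm]
  simp_rw [h1]
  rw [Finset.sum_comm]
  refine Finset.sum_congr rfl fun j _ => ?_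
  rw [← sum_inner, ← map_sum, e.sum_repr']

theorem sum_re_inner_apply_eq {ι κ : Type*} [Fintype ι] [Fintype κ] (e : OrthonormalBasis ι ℂ W)
    (f : OrthonormalBasis κ ℂ W) (P : W →ₗ[ℂ] H) (T : H →L[ℂ] H) :
    ∑ i, (⟪P (e i), T (P (e i))⟫_ℂ).re = ∑ j, (⟪P (f j), T (P (f j))⟫_ℂ).re := by
  have := congrArg Complex.re (sum_inner_apply_eq e f P (T.toLinearMap ∘ₗ P))
  simpa [Complex.re_sum] using this

theorem IsSingularBasis.norm_sq {ι : Type*} [Fintype ι] {M : W →ₗ[ℂ] H}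
    {e : OrthonormalBasis ι ℂ W} (h : IsSingularBasis M e) (x : W) :
    ‖M x‖ ^ 2 = ∑ i, ‖M (e i)‖ ^ 2 * ‖⟪e i, x⟫_ℂ‖ ^ 2 := by
  classical
  have h2 : ∀ i, ⟪M (e i), M x⟫_ℂ = ⟪e i, x⟫_ℂ * ((‖M (e i)‖ ^ 2 : ℝ) : ℂ) := by
    intro i
    conv_lhs => rw [← e.sum_repr' x, map_sum, inner_sum]
    rw [Finset.sum_eq_single i (fun j _ hji => by
      rw [map_smul, inner_smul_right, h hji.symm, mul_zero])
      (fun h => absurd (Finset.mem_univ i) h), map_smul, inner_smul_right,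
      inner_self_eq_ofReal]
  have h3 : ⟪M x, M x⟫_ℂ = ∑ i, ((‖M (e i)‖ ^ 2 * ‖⟪e i, x⟫_ℂ‖ ^ 2 : ℝ) : ℂ) := by
    conv_lhs => rw [← e.sum_repr' x, map_sum, sum_inner]
    refine Finset.sum_congr rfl fun i _ => ?_
    rw [map_smul, inner_smul_left, ← map_sum, e.sum_repr', h2, ← mul_assoc, mul_comm (starRingEnd ℂ _),
      Complex.mul_conj, Complex.normSq_eq_norm_sq]
    push_cast
    ring
  rw [← re_inner_self_eq, h3, ← Complex.ofReal_sum, Complex.ofReal_re]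

end SingularBasis

/-! ### Concavity theorems of Lieb and Epstein -/

section Resolvent

variable {H : Type*} [NormedAddCommGroup H] [InnerProductSpace ℂ H] [CompleteSpace H]

theorem exists_apply_add_smul_eq {B : H →L[ℂ] H} (hB : B.IsPositive) {t : ℝ} (ht : 0 < t) (v : H) :
    ∃ w, B w + (t : ℂ) • w = v := by
  have h : (-t) ∉ spectrum ℝ B := fun h => by
    have := spectrum_nonneg_of_nonneg (nonneg_of_isPositive hB) h
    linarith
  obtain ⟨u, hu⟩ := spectrum.notMem_iff.1 h
  refine ⟨-((↑u⁻¹ : H →L[ℂ] H) v), ?_⟩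
  have h1 : (u : H →L[ℂ] H) ((↑u⁻¹ : H →L[ℂ] H) v) = v := by
    rw [← mul_apply_eq_comp, Units.mul_inv, one_apply_eq_self]
  rw [hu] at h1
  simp only [Algebra.algebraMap_eq_smul_one, sub_apply, smul_apply, one_apply_eq_self,
    ← Complex.coe_smul] at h1
  rw [map_neg, smul_neg]
  conv_rhs => rw [← h1]
  simp only [Complex.ofReal_neg, neg_smul]
  abel

theorem cfcn_rpowIntegrand_apply {B : H →L[ℂ] H} (hB : B.IsPositive) {p t : ℝ}
    (hp : p ∈ Set.Ioo 0 1) (ht : 0 < t) (w : H) :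
    cfcₙ (Real.rpowIntegrand₀₁ p t) B (B w + (t : ℂ) • w) = ((t ^ (p - 1) : ℝ) : ℂ) • B w := by
  have hB0 := nonneg_of_isPositive hB
  have hpos : ∀ x ∈ spectrum ℝ B, 0 ≤ x := fun x hx => spectrum_nonneg_of_nonneg hB0 hx
  have hc : ContinuousOn (Real.rpowIntegrand₀₁ p t) (spectrum ℝ B) :=
    (Real.continuousOn_rpowIntegrand₀₁_Ici hp ht).mono hpos
  have h0 : Real.rpowIntegrand₀₁ p t 0 = 0 := Real.rpowIntegrand₀₁_zero_right
  have h1 : cfc (Real.rpowIntegrand₀₁ p t) B * cfc (fun x : ℝ => x + t) B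
      = cfc (fun x : ℝ => t ^ (p - 1) * x) B := by
    rw [← cfc_mul _ _ B hc (by fun_prop)]
    refine cfc_congr fun x hx => ?_
    have hx0 := hpos x hx
    rw [Real.rpowIntegrand₀₁_eq_pow_div hp ht.le hx0]
    field_simp
    ring
  rw [cfc_const_mul_id _ B hB.isSelfAdjoint, cfc_add_const _ _ B (by fun_prop) hB.isSelfAdjoint,
    cfc_id' ℝ B hB.isSelfAdjoint] at h1
  have h2 := congrArg (fun T : H →L[ℂ] H => T w) h1
  have hcq : ContinuousOn (Real.rpowIntegrand₀₁ p t) (quasispectrum ℝ B) :=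
    (Real.continuousOn_rpowIntegrand₀₁_Ici hp ht).mono fun x hx =>
      quasispectrum_nonneg_of_nonneg B hB0 x hx
  rw [cfcₙ_eq_cfc (hf := hcq) (hf0 := h0)]
  simpa [Algebra.algebraMap_eq_smul_one, mul_apply_eq_comp, ← Complex.coe_smul] using h2

/-- `t^(2-p) ⟪v, f_t(B) v⟫`, for the integrand `f_t(x) = t^(p-1) x / (t + x)` of `x ^ p`, is the
quadratic form of a parallel sum, hence a minimum of expressions that are linear in `B`. -/
theorem isLeast_cfcn_rpowIntegrand {B : H →L[ℂ] H} (hB : B.IsPositive) {p t : ℝ}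
    (hp : p ∈ Set.Ioo 0 1) (ht : 0 < t) (v : H) :
    IsLeast (Set.range fun z => t ^ (p - 2) * ((⟪z, B z⟫_ℂ).re + t * ‖v - z‖ ^ 2))
      (⟪v, cfcₙ (Real.rpowIntegrand₀₁ p t) B v⟫_ℂ).re := by
  obtain ⟨w, rfl⟩ := exists_apply_add_smul_eq hB ht v
  rw [cfcn_rpowIntegrand_apply hB hp ht]
  have hsym : ∀ x y : H, ⟪B x, y⟫_ℂ = ⟪x, B y⟫_ℂ := hB.isSelfAdjoint.isSymmetric
  have htp : t ^ (p - 1) = t ^ (p - 2) * t := by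
    rw [← Real.rpow_add_one ht.ne']; congr 1; ring
  have hmin : (⟪B w + (t : ℂ) • w, ((t ^ (p - 1) : ℝ) : ℂ) • B w⟫_ℂ).re
      = t ^ (p - 2) * (t * (‖B w‖ ^ 2 + t * (⟪w, B w⟫_ℂ).re)) := by
    rw [inner_smul_right, inner_add_left, inner_smul_left, Complex.conj_ofReal,
      Complex.re_ofReal_mul, Complex.add_re, Complex.re_ofReal_mul, re_inner_self_eq, htp]
    ring
  rw [hmin]
  constructor
  · refine ⟨(t : ℂ) • w, ?_⟩
    simp only [add_sub_cancel_right, map_smul, inner_smul_left, inner_smul_right,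
      Complex.conj_ofReal, Complex.re_ofReal_mul]
    ring
  · rintro _ ⟨z, rfl⟩
    simp only
    refine mul_le_mul_of_nonneg_left ?_ (Real.rpow_nonneg ht.le _)
    -- complete the square around the minimizer `t w`
    obtain ⟨d, rfl⟩ : ∃ d, z = (t : ℂ) • w + d := ⟨z - (t : ℂ) • w, by abel⟩
    have h1 : (⟪(t : ℂ) • w + d, B ((t : ℂ) • w + d)⟫_ℂ).re
        = t * (t * (⟪w, B w⟫_ℂ).re) + 2 * t * (⟪B w, d⟫_ℂ).re + (⟪d, B d⟫_ℂ).re := by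
      have h2 : (⟪d, B w⟫_ℂ).re = (⟪B w, d⟫_ℂ).re := by
        rw [← inner_conj_symm, Complex.conj_re]
      rw [map_add, map_smul]
      simp only [inner_add_left, inner_add_right, inner_smul_left, inner_smul_right,
        Complex.conj_ofReal, Complex.re_ofReal_mul, Complex.add_re, h2, ← hsym w d]
      ring
    have h3 : ‖B w + (t : ℂ) • w - ((t : ℂ) • w + d)‖ ^ 2
        = ‖B w‖ ^ 2 - 2 * (⟪B w, d⟫_ℂ).re + ‖d‖ ^ 2 := by
      rw [show B w + (t : ℂ) • w - ((t : ℂ) • w + d) = B w - d by abel]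
      exact norm_sub_sq (𝕜 := ℂ) _ _
    rw [h1, h3]
    nlinarith [re_inner_nonneg hB d, mul_nonneg ht.le (sq_nonneg ‖d‖)]

/-- The form `y ⟪v, f_t(A / y) v⟫` of the perspective of `f_t(x) = t^(p-1) x / (t + x)`, with
value `0` at `y = 0`, is a minimum of expressions that are jointly linear in `A` and `y`. -/
theorem isLeast_perspective {A : H →L[ℂ] H} (hA : A.IsPositive) {p t y : ℝ}
    (hp : p ∈ Set.Ioo 0 1) (ht : 0 < t) (hy : 0 ≤ y) (v : H) :
    IsLeast (Set.range fun z => t ^ (p - 2) * ((⟪z, A z⟫_ℂ).re + t * (y * ‖v - z‖ ^ 2)))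
      (y * (⟪v, cfcₙ (Real.rpowIntegrand₀₁ p t) (((y⁻¹ : ℝ) : ℂ) • A) v⟫_ℂ).re) := by
  rcases hy.eq_or_lt with rfl | hy
  · refine ⟨⟨0, by simp⟩, ?_⟩
    rintro _ ⟨z, rfl⟩
    have := re_inner_nonneg hA z
    have := Real.rpow_nonneg ht.le (p - 2)
    simp only [zero_mul, mul_zero, add_zero]
    positivity
  · have hB : (((y⁻¹ : ℝ) : ℂ) • A).IsPositive :=
      hA.smul_of_nonneg (by exact_mod_cast (inv_pos.2 hy).le)
    have h := isLeast_cfcn_rpowIntegrand hB hp ht v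
    have e : ∀ z, t ^ (p - 2) * ((⟪z, A z⟫_ℂ).re + t * (y * ‖v - z‖ ^ 2))
        = y * (t ^ (p - 2) * ((⟪z, (((y⁻¹ : ℝ) : ℂ) • A) z⟫_ℂ).re + t * ‖v - z‖ ^ 2)) := by
      intro z
      rw [smul_apply, inner_smul_right, Complex.re_ofReal_mul]
      field_simp
    simp only [e]
    obtain ⟨⟨z, hz⟩, h2⟩ := h
    refine ⟨⟨z, congrArg (y * ·) hz⟩, ?_⟩
    rintro _ ⟨z, rfl⟩
    exact mul_le_mul_of_nonneg_left (h2 ⟨z, rfl⟩) hy.le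

theorem smul_rpow_of_nonneg {A : H →L[ℂ] H} (hA : A.IsPositive) {p c : ℝ} (hc : 0 ≤ c)
    (hp : 0 ≤ p) : ((c : ℂ) • A) ^ p = ((c ^ p : ℝ) : ℂ) • A ^ p := by
  have hB : ((c : ℂ) • A).IsPositive := hA.smul_of_nonneg (by exact_mod_cast hc)
  rw [CFC.rpow_eq_cfc_real (nonneg_of_isPositive hB),
    CFC.rpow_eq_cfc_real (nonneg_of_isPositive hA), Complex.coe_smul, Complex.coe_smul,
    ← cfc_comp_const_mul c (fun x => x ^ p) A (Real.continuous_rpow_const hp).continuousOn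
      hA.isSelfAdjoint, ← cfc_const_mul _ _ A (Real.continuous_rpow_const hp).continuousOn]
  refine cfc_congr fun x hx => ?_
  exact Real.mul_rpow hc (spectrum_nonneg_of_nonneg (nonneg_of_isPositive hA) hx)

open MeasureTheory in
/-- Integral representation of `y^(1-p) ⟪v, A^p v⟫`, `0 < p < 1`, by perspectives of
`f_t(x) = t^(p-1) x / (t + x)`. -/
theorem exists_measure_rpow_perspective {p : ℝ} (hp : p ∈ Set.Ioo 0 1) :
    ∃ μ : Measure ℝ, ∀ A : H →L[ℂ] H, A.IsPositive → ∀ y : ℝ, 0 ≤ y → ∀ v : H,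
      IntegrableOn (fun t => y * (⟪v, cfcₙ (Real.rpowIntegrand₀₁ p t)
        (((y⁻¹ : ℝ) : ℂ) • A) v⟫_ℂ).re) (Set.Ioi 0) μ ∧
      y ^ (1 - p) * (⟪v, (A ^ p) v⟫_ℂ).re = ∫ t in Set.Ioi 0, y * (⟪v, cfcₙ
        (Real.rpowIntegrand₀₁ p t) (((y⁻¹ : ℝ) : ℂ) • A) v⟫_ℂ).re ∂μ := by
  have hp0 : 0 < p := hp.1
  lift p to ℝ≥0 using hp0.le
  have hp0' : 0 < p := by exact_mod_cast hp0
  have hp1 : (p : ℝ) < 1 := hp.2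
  obtain ⟨μ, hμ⟩ := CFC.exists_measure_nnrpow_eq_integral_cfcₙ_rpowIntegrand₀₁
    (A := H →L[ℂ] H) (p := p) ⟨hp0', by exact_mod_cast hp1⟩
  refine ⟨μ, fun A hA y hy v => ?_⟩
  rcases hy.eq_or_lt with rfl | hy
  · simp [Real.zero_rpow (sub_pos.2 hp1).ne']
  · have hy' : 0 ≤ y⁻¹ := (inv_pos.2 hy).le
    have hB : (((y⁻¹ : ℝ) : ℂ) • A).IsPositive := hA.smul_of_nonneg (by exact_mod_cast hy')
    obtain ⟨hi, he⟩ := hμ _ (nonneg_of_isPositive hB)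
    let φ : (H →L[ℂ] H) →L[ℝ] ℝ := Complex.reCLM ∘L
      ((innerSL ℂ v).restrictScalars ℝ) ∘L ((ContinuousLinearMap.apply ℂ H v).restrictScalars ℝ)
    have hφ : ∀ T : H →L[ℂ] H, φ T = (⟪v, T v⟫_ℂ).re := fun T => rfl
    have h1 := φ.integrable_comp hi
    have h2 := φ.integral_comp_comm hi
    simp only [hφ] at h1 h2
    refine ⟨h1.const_mul y, ?_⟩
    rw [integral_const_mul, h2, ← he, CFC.nnrpow_eq_rpow hp0', smul_rpow_of_nonneg hA hy' p.coe_nonneg,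
      smul_apply, inner_smul_right, Complex.re_ofReal_mul, ← mul_assoc]
    congr 1
    rw [Real.rpow_sub hy, Real.rpow_one, Real.inv_rpow hy.le]
    rfl

end Resolvent

section Concavity

variable {H W : Type*} [NormedAddCommGroup H] [InnerProductSpace ℂ H]
  [NormedAddCommGroup W] [InnerProductSpace ℂ W]

/-- An eigenbasis `f`, with eigenvalues `y`, of the sum of the two nonnegative operators
`∑ᵢ wᵢ |eᵢ⟩⟨eᵢ|` and `∑ᵢ wᵢ' |eᵢ'⟩⟨eᵢ'|`. -/
theorem exists_eigenbasis_add [FiniteDimensional ℂ W] {ι κ : Type*} [Fintype ι] [Fintype κ]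
    (e : OrthonormalBasis ι ℂ W) (e' : OrthonormalBasis κ ℂ W) {w : ι → ℝ} {w' : κ → ℝ}
    (hw : ∀ i, 0 ≤ w i) (hw' : ∀ i, 0 ≤ w' i) :
    ∃ (f : OrthonormalBasis (Fin (Module.finrank ℂ W)) ℂ W) (y : Fin (Module.finrank ℂ W) → ℝ),
      (∀ j, 0 ≤ y j) ∧ ∀ j, (y j : ℂ) • f j =
        ∑ i, (w i : ℂ) • ⟪e i, f j⟫_ℂ • e i + ∑ i, (w' i : ℂ) • ⟪e' i, f j⟫_ℂ • e' i := by
  let T : W →ₗ[ℂ] W := ∑ i, (w i : ℂ) • (innerₛₗ ℂ (e i)).smulRight (e i)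
    + ∑ i, (w' i : ℂ) • (innerₛₗ ℂ (e' i)).smulRight (e' i)
  have hTx : ∀ x, T x = ∑ i, (w i : ℂ) • ⟪e i, x⟫_ℂ • e i
      + ∑ i, (w' i : ℂ) • ⟪e' i, x⟫_ℂ • e' i := by
    intro x
    simp [T, LinearMap.sum_apply]
  have hT : T.IsSymmetric := by
    intro x y
    rw [hTx, hTx]
    simp only [inner_add_left, inner_add_right, sum_inner, inner_sum, inner_smul_left,
      inner_smul_right, Complex.conj_ofReal, inner_conj_symm]
    congr 1 <;> exact Finset.sum_congr rfl fun i _ => by ring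
  have hpos : ∀ x, 0 ≤ (⟪x, T x⟫_ℂ).re := by
    intro x
    have h : ∀ v : W, ⟪v, x⟫_ℂ * ⟪x, v⟫_ℂ = ((‖⟪v, x⟫_ℂ‖ ^ 2 : ℝ) : ℂ) := by
      intro v
      rw [← inner_conj_symm x v, Complex.mul_conj, Complex.normSq_eq_norm_sq]
    rw [hTx]
    simp only [inner_add_right, inner_sum, inner_smul_right, h, Complex.add_re, Complex.re_sum,
      Complex.re_ofReal_mul, Complex.ofReal_re]
    exact add_nonneg (Finset.sum_nonneg fun i _ => mul_nonneg (hw i) (sq_nonneg _))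
      (Finset.sum_nonneg fun i _ => mul_nonneg (hw' i) (sq_nonneg _))
  refine ⟨hT.eigenvectorBasis rfl, hT.eigenvalues rfl, fun j => ?_, fun j => ?_⟩
  · have h := hpos (hT.eigenvectorBasis rfl j)
    rw [hT.apply_eigenvectorBasis, inner_smul_right] at h
    simpa [inner_self_eq_norm_sq_to_K] using h
  · rw [← hTx, hT.apply_eigenvectorBasis]
    rfl

theorem sum_mul_norm_sq_eq_add {ι κ ν : Type*} [Fintype ι] [Fintype κ] [Fintype ν]
    {e : OrthonormalBasis ι ℂ W} {e' : OrthonormalBasis κ ℂ W} {f : OrthonormalBasis ν ℂ W}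
    {w : ι → ℝ} {w' : κ → ℝ} {y : ν → ℝ}
    (h : ∀ j, (y j : ℂ) • f j =
        ∑ i, (w i : ℂ) • ⟪e i, f j⟫_ℂ • e i + ∑ i, (w' i : ℂ) • ⟪e' i, f j⟫_ℂ • e' i)
    (M : W →ₗ[ℂ] H) :
    ∑ j, y j * ‖M (f j)‖ ^ 2 = ∑ i, w i * ‖M (e i)‖ ^ 2 + ∑ i, w' i * ‖M (e' i)‖ ^ 2 := by
  have key : ∀ v : W, ∑ j, ⟪f j, v⟫_ℂ • M (f j) = M v := fun v => by
    simp_rw [← map_smul, ← map_sum, f.sum_repr']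
  have h1 : ∀ j, ((y j * ‖M (f j)‖ ^ 2 : ℝ) : ℂ)
      = ∑ i, (w i : ℂ) * ⟪⟪f j, e i⟫_ℂ • M (f j), M (e i)⟫_ℂ
        + ∑ i, (w' i : ℂ) * ⟪⟪f j, e' i⟫_ℂ • M (f j), M (e' i)⟫_ℂ := by
    intro j
    have h2 : ((y j * ‖M (f j)‖ ^ 2 : ℝ) : ℂ) = ⟪M (f j), M ((y j : ℂ) • f j)⟫_ℂ := by
      rw [map_smul, inner_smul_right, inner_self_eq_ofReal, Complex.ofReal_mul]
    rw [h2, h j]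
    simp only [map_add, map_sum, map_smul, inner_add_right, inner_sum, inner_smul_right,
      inner_smul_left, inner_conj_symm]
  have h3 : ((∑ j, y j * ‖M (f j)‖ ^ 2 : ℝ) : ℂ)
      = ((∑ i, w i * ‖M (e i)‖ ^ 2 + ∑ i, w' i * ‖M (e' i)‖ ^ 2 : ℝ) : ℂ) := by
    rw [Complex.ofReal_sum]
    simp_rw [h1]
    rw [Finset.sum_add_distrib, Finset.sum_comm, Finset.sum_comm (f := fun j i => (w' i : ℂ) * _)]
    simp_rw [← Finset.mul_sum, ← sum_inner, key, inner_self_eq_ofReal]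
    push_cast
    rfl
  exact_mod_cast h3

variable [CompleteSpace H]

/-- Lieb's concavity theorem: `(A, Y) ↦ tr (L* A^p L Y^(1-p))` is superadditive. The operators
`∑ᵢ wᵢ |eᵢ⟩⟨eᵢ|`, `∑ᵢ wᵢ' |eᵢ'⟩⟨eᵢ'|` and their sum `∑ⱼ yⱼ |fⱼ⟩⟨fⱼ|` are in diagonal form. -/
theorem sum_rpow_mul_re_inner_rpow_superadditive {ι κ ν : Type*} [Fintype ι] [Fintype κ]
    [Fintype ν] {e : OrthonormalBasis ι ℂ W} {e' : OrthonormalBasis κ ℂ W}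
    {f : OrthonormalBasis ν ℂ W} {w : ι → ℝ} {w' : κ → ℝ} {y : ν → ℝ}
    (hw : ∀ i, 0 ≤ w i) (hw' : ∀ i, 0 ≤ w' i) (hy : ∀ j, 0 ≤ y j)
    (hmix : ∀ M : W →ₗ[ℂ] H, ∑ j, y j * ‖M (f j)‖ ^ 2
      = ∑ i, w i * ‖M (e i)‖ ^ 2 + ∑ i, w' i * ‖M (e' i)‖ ^ 2)
    {A B : H →L[ℂ] H} (hA : A.IsPositive) (hB : B.IsPositive) {p : ℝ} (hp : p ∈ Set.Ioo 0 1)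
    (L : W →ₗ[ℂ] H) :
    ∑ i, w i ^ (1 - p) * (⟪L (e i), (A ^ p) (L (e i))⟫_ℂ).re
      + ∑ i, w' i ^ (1 - p) * (⟪L (e' i), (B ^ p) (L (e' i))⟫_ℂ).re
      ≤ ∑ j, y j ^ (1 - p) * (⟪L (f j), ((A + B) ^ p) (L (f j))⟫_ℂ).re := by
  obtain ⟨μ, hμ⟩ := exists_measure_rpow_perspective (H := H) hp
  have hAB := hA.add hB
  rw [Finset.sum_congr rfl fun i _ => (hμ A hA (w i) (hw i) (L (e i))).2,
    Finset.sum_congr rfl fun i _ => (hμ B hB (w' i) (hw' i) (L (e' i))).2,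
    Finset.sum_congr rfl fun j _ => (hμ _ hAB (y j) (hy j) (L (f j))).2,
    ← MeasureTheory.integral_finsetSum _ fun i _ => (hμ A hA (w i) (hw i) (L (e i))).1,
    ← MeasureTheory.integral_finsetSum _ fun i _ => (hμ B hB (w' i) (hw' i) (L (e' i))).1,
    ← MeasureTheory.integral_finsetSum _ fun j _ => (hμ _ hAB (y j) (hy j) (L (f j))).1,
    ← MeasureTheory.integral_add
      (MeasureTheory.integrable_finsetSum _ fun i _ => (hμ A hA (w i) (hw i) (L (e i))).1)
      (MeasureTheory.integrable_finsetSum _ fun i _ => (hμ B hB (w' i) (hw' i) (L (e' i))).1)]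
  refine MeasureTheory.setIntegral_mono_on
    ((MeasureTheory.integrable_finsetSum _ fun i _ => (hμ A hA (w i) (hw i) (L (e i))).1).add
      (MeasureTheory.integrable_finsetSum _ fun i _ => (hμ B hB (w' i) (hw' i) (L (e' i))).1))
    (MeasureTheory.integrable_finsetSum _ fun j _ => (hμ _ hAB (y j) (hy j) (L (f j))).1)
    measurableSet_Ioi fun t ht => ?_
  have ht : 0 < t := ht
  -- the minimizers for the sum, assembled to an operator `Z`, are competitors for the summands
  choose z hz using fun j => (isLeast_perspective hAB hp ht (hy j) (L (f j))).1
  let Z : W →ₗ[ℂ] H := f.toBasis.constr ℂ z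
  have hZ : ∀ j, Z (f j) = z j := fun j => by
    simpa only [f.coe_toBasis] using f.toBasis.constr_basis ℂ z j
  have h1 : ∑ j, y j * (⟪L (f j), cfcₙ (Real.rpowIntegrand₀₁ p t)
        ((((y j)⁻¹ : ℝ) : ℂ) • (A + B)) (L (f j))⟫_ℂ).re
      = ∑ i, t ^ (p - 2) * ((⟪Z (e i), A (Z (e i))⟫_ℂ).re
          + t * (w i * ‖L (e i) - Z (e i)‖ ^ 2))
        + ∑ i, t ^ (p - 2) * ((⟪Z (e' i), B (Z (e' i))⟫_ℂ).re
          + t * (w' i * ‖L (e' i) - Z (e' i)‖ ^ 2)) := by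
    rw [← Finset.sum_congr rfl fun j _ => hz j]
    simp only [← hZ, ← LinearMap.sub_apply, ← Finset.mul_sum, Finset.sum_add_distrib, hmix,
      add_apply, inner_add_right, Complex.add_re, sum_re_inner_apply_eq f e Z A,
      sum_re_inner_apply_eq f e' Z B]
    ring
  rw [h1]
  exact add_le_add
    (Finset.sum_le_sum fun i _ => (isLeast_perspective hA hp ht (hw i) (L (e i))).2 ⟨_, rfl⟩)
    (Finset.sum_le_sum fun i _ => (isLeast_perspective hB hp ht (hw' i) (L (e' i))).2 ⟨_, rfl⟩)

/-- Epstein's concavity theorem: `A ↦ tr (L* A^p L)^(1/p)` is superadditive for `0 < p ≤ 1`, and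
homogeneous of degree one. For `p < 1` it is the maximum over `Y ≥ 0` of
`p⁻¹ tr (L* A^p L Y^(1-p)) - (p⁻¹ - 1) tr Y`, which is jointly concave in `A` and `Y` by Lieb's
theorem. -/
theorem sum_norm_rpow_superadditive [FiniteDimensional ℂ W] {ι κ ν : Type*} [Fintype ι]
    [Fintype κ] [Fintype ν] {A B : H →L[ℂ] H} (hA : A.IsPositive) (hB : B.IsPositive) {p : ℝ}
    (hp0 : 0 < p) (hp1 : p ≤ 1) (L : W →ₗ[ℂ] H) {e : OrthonormalBasis ι ℂ W}
    {e' : OrthonormalBasis κ ℂ W} {g : OrthonormalBasis ν ℂ W}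
    (hg : IsSingularBasis (((A + B) ^ (p / 2) : H →L[ℂ] H).toLinearMap ∘ₗ L) g) :
    ∑ i, (‖(A ^ (p / 2)) (L (e i))‖ ^ 2) ^ p⁻¹ + ∑ i, (‖(B ^ (p / 2)) (L (e' i))‖ ^ 2) ^ p⁻¹
      ≤ ∑ k, (‖((A + B) ^ (p / 2)) (L (g k))‖ ^ 2) ^ p⁻¹ := by
  have hsq : ∀ (T : H →L[ℂ] H) (x : H), ‖(T ^ (p / 2)) x‖ ^ 2 = (⟪x, (T ^ p) x⟫_ℂ).re := by
    intro T x
    rw [norm_sq_rpow_apply T (half_pos hp0), mul_div_cancel₀ p two_ne_zero]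
  rcases hp1.eq_or_lt with rfl | hp1
  · simp only [hsq, inv_one, Real.rpow_one, CFC.rpow_one A (nonneg_of_isPositive hA),
      CFC.rpow_one B (nonneg_of_isPositive hB),
      CFC.rpow_one (A + B) (nonneg_of_isPositive (hA.add hB)), sum_re_inner_apply_eq e g,
      sum_re_inner_apply_eq e' g, add_apply, inner_add_right, Complex.add_re,
      Finset.sum_add_distrib, le_refl]
  · set a : ι → ℝ := fun i => (‖(A ^ (p / 2)) (L (e i))‖ ^ 2) ^ p⁻¹ with ha
    set b : κ → ℝ := fun i => (‖(B ^ (p / 2)) (L (e' i))‖ ^ 2) ^ p⁻¹ with hb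
    have ha0 : ∀ i, 0 ≤ a i := fun i => by positivity
    have hb0 : ∀ i, 0 ≤ b i := fun i => by positivity
    obtain ⟨f, y, hy, hf⟩ := exists_eigenbasis_add e e' ha0 hb0
    have hlieb := sum_rpow_mul_re_inner_rpow_superadditive ha0 hb0 hy
      (fun M => sum_mul_norm_sq_eq_add hf M) hA hB ⟨hp0, hp1⟩ L
    have hsum : ∑ j, y j = ∑ i, a i + ∑ i, b i := by
      simpa using sum_mul_norm_sq_eq_add hf LinearMap.id
    have hpow : ∀ x : ℝ, 0 ≤ x → (x ^ p⁻¹) ^ (1 - p) * x = x ^ p⁻¹ := by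
      intro x hx
      rcases hx.eq_or_lt with rfl | hx
      · rw [mul_zero, Real.zero_rpow (inv_pos.2 hp0).ne']
      · rw [← Real.rpow_mul hx.le, ← Real.rpow_add_one hx.ne']
        congr 1
        field_simp
        ring
    simp only [← hsq] at hlieb
    rw [Finset.sum_congr rfl fun i _ => hpow _ (sq_nonneg ‖(A ^ (p / 2)) (L (e i))‖),
      Finset.sum_congr rfl fun i _ => hpow _ (sq_nonneg ‖(B ^ (p / 2)) (L (e' i))‖)] at hlieb
    have hyoung : ∀ j, y j ^ (1 - p) * ‖((A + B) ^ (p / 2)) (L (f j))‖ ^ 2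
        ≤ ∑ k, (p * (‖((A + B) ^ (p / 2)) (L (g k))‖ ^ 2) ^ p⁻¹ + (1 - p) * y j)
          * ‖⟪g k, f j⟫_ℂ‖ ^ 2 := by
      intro j
      have h1 := hg.norm_sq (f j)
      simp only [LinearMap.comp_apply, ContinuousLinearMap.coe_coe] at h1
      rw [h1, Finset.mul_sum]
      refine Finset.sum_le_sum fun k _ => ?_
      rw [← mul_assoc]
      refine mul_le_mul_of_nonneg_right ?_ (sq_nonneg _)
      have h2 := Real.geom_mean_le_arith_mean2_weighted hp0.le (sub_pos.2 hp1).le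
        (Real.rpow_nonneg (sq_nonneg ‖((A + B) ^ (p / 2)) (L (g k))‖) p⁻¹) (hy j) (by ring)
      rwa [Real.rpow_inv_rpow (sq_nonneg _) hp0.ne', mul_comm] at h2
    have hds : ∑ j, ∑ k, (p * (‖((A + B) ^ (p / 2)) (L (g k))‖ ^ 2) ^ p⁻¹ + (1 - p) * y j)
          * ‖⟪g k, f j⟫_ℂ‖ ^ 2
        = p * ∑ k, (‖((A + B) ^ (p / 2)) (L (g k))‖ ^ 2) ^ p⁻¹ + (1 - p) * ∑ j, y j := by
      simp only [add_mul, Finset.sum_add_distrib]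
      congr 1
      · rw [Finset.sum_comm, Finset.mul_sum]
        refine Finset.sum_congr rfl fun k _ => ?_
        rw [← Finset.mul_sum, f.sum_sq_norm_inner_left, g.norm_eq_one, one_pow, mul_one]
      · rw [Finset.mul_sum]
        refine Finset.sum_congr rfl fun j _ => ?_
        rw [← Finset.mul_sum, g.sum_sq_norm_inner_right, f.norm_eq_one, one_pow, mul_one]
    have h := hlieb.trans ((Finset.sum_le_sum fun j _ => hyoung j).trans_eq hds)
    rw [hsum] at h
    have h' : p * (∑ i, a i + ∑ i, b i)
        ≤ p * ∑ k, (‖((A + B) ^ (p / 2)) (L (g k))‖ ^ 2) ^ p⁻¹ := by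
      simp only [ha, hb] at h ⊢
      linarith
    exact le_of_mul_le_mul_left h' hp0

end Concavity

/-! ### Joint convexity for `α > 1` -/

section Convex

variable {H : Type*} [NormedAddCommGroup H] [InnerProductSpace ℂ H]

theorem norm_compression_le (U : Submodule ℂ H) [U.HasOrthogonalProjection] (X : H →L[ℂ] H) :
    ‖U.starProjection ∘L X ∘L U.starProjection‖ ≤ ‖X‖ := by
  refine ContinuousLinearMap.opNorm_le_bound _ (norm_nonneg _) fun x => ?_
  calc _ ≤ ‖X (U.starProjection x)‖ := U.norm_starProjection_apply_le _
    _ ≤ ‖X‖ * ‖U.starProjection x‖ := X.le_opNorm _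
    _ ≤ _ := by gcongr; exact U.norm_starProjection_apply_le _

variable [CompleteSpace H]

theorem rpow_apply_eq_zero_of_apply_eq_zero {σ : H →L[ℂ] H} (hσ : σ.IsPositive) {s : ℝ}
    (hs : 0 < s) {x : H} (hx : σ x = 0) : (σ ^ s) x = 0 := by
  have h := rpow_apply_of_apply_eq_smul hσ hs le_rfl (x := x) (by simpa using hx)
  simpa [Real.zero_rpow hs.ne'] using h

/-- Douglas' factorization: `σ^(-β) ρ σ^(-β)` exists as soon as `ρ ≤ c σ^(2β)`. -/
theorem exists_isNegSandwich {β c : ℝ} (h0 : 0 < β) {ρ σ : H →L[ℂ] H}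
    (hρ : ρ.IsPositive) (hσ : σ.IsPositive) (hc : 0 ≤ c)
    (h : ∀ x, (⟪x, ρ x⟫_ℂ).re ≤ c * (⟪x, (σ ^ (2 * β)) x⟫_ℂ).re) :
    ∃ X, IsNegSandwich β ρ σ X := by
  set S : H →L[ℂ] H := σ ^ β with hS
  set R : H →L[ℂ] H := ρ ^ (1 / 2 : ℝ) with hR
  have hRR : ∀ x y, ⟪R x, R y⟫_ℂ = ⟪x, ρ y⟫_ℂ := inner_rpow_half hρ
  let K : Submodule ℂ H := S.range.topologicalClosure
  have : CompleteSpace K := S.range.isClosed_topologicalClosure.completeSpace_coe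
  have hSK : ∀ x, S x ∈ K := fun x => S.range.le_topologicalClosure ⟨x, rfl⟩
  let E : H →ₗ[ℂ] K := S.toLinearMap.codRestrict K hSK
  have hE : DenseRange E := by
    intro x
    rw [closure_subtype]
    have h1 : ((↑) '' Set.range E : Set H) = S.range := by
      ext y
      simp [E]
    rw [h1]
    exact x.2
  let D₀ : K →L[ℂ] H := R.toLinearMap.extendOfNorm E
  have hD₀ : ∀ x, D₀ (E x) = R x := by
    refine fun x => LinearMap.extendOfNorm_eq hE ⟨√c, fun x => ?_⟩ x
    have h1 : ‖R x‖ ^ 2 ≤ (√c * ‖S x‖) ^ 2 := by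
      rw [mul_pow, Real.sq_sqrt hc, hS, norm_sq_rpow_apply σ h0, ← re_inner_self_eq, hRR]
      exact h x
    exact le_of_sq_le_sq h1 (by positivity)
  let D : H →L[ℂ] H := D₀ ∘L K.orthogonalProjectionOnto
  have hD : ∀ x, D (S x) = R x := by
    intro x
    rw [← hD₀ x]
    change D₀ (K.orthogonalProjectionOnto (E x : H)) = _
    rw [Submodule.orthogonalProjectionOnto_mem_subspace_eq_self]
  refine ⟨D.adjoint ∘L D, ContinuousLinearMap.isPositive_adjoint_comp_self D, fun x hx => ?_, ?_⟩
  · have hx' : x ∈ Kᗮ := by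
      rw [Submodule.orthogonal_closure]
      rintro _ ⟨y, rfl⟩
      change ⟪S y, x⟫_ℂ = 0
      rw [hS, inner_rpow_left, rpow_apply_eq_zero_of_apply_eq_zero hσ h0 hx, inner_zero_right]
    have : D x = 0 := by
      change D₀ (K.orthogonalProjectionOnto x) = 0
      rw [Submodule.orthogonalProjectionOnto_apply_of_mem_orthogonal hx', map_zero]
    rw [ContinuousLinearMap.comp_apply, this, map_zero]
  · refine ContinuousLinearMap.ext fun y => ext_inner_left ℂ fun x => ?_
    rw [mul_apply_eq_comp, mul_apply_eq_comp, ContinuousLinearMap.comp_apply, ← inner_rpow_left,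
      ContinuousLinearMap.adjoint_inner_right, ← hRR, ← hD x, ← hD y]

variable {W : Type*} [NormedAddCommGroup W] [InnerProductSpace ℂ W]

/-- The trace Young inequality `tr (M* X M) ≤ tr X^a / a + tr (M* M)^b / b`. -/
theorem sum_re_inner_le_trace_rpow {ι : Type*} [Fintype ι] {X : H →L[ℂ] H} (hX : X.IsPositive)
    {a b : ℝ} (hab : a.HolderConjugate b) (htr : trace (X ^ a) ≠ ∞) {M : W →ₗ[ℂ] H}
    {e : OrthonormalBasis ι ℂ W} (he : IsSingularBasis M e) :
    ∑ i, (⟪M (e i), X (M (e i))⟫_ℂ).re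
      ≤ (trace (X ^ a)).toReal / a + (∑ i, (‖M (e i)‖ ^ 2) ^ b) / b := by
  classical
  have hh := orthonormal_normalize he
  set h : {i // M (e i) ≠ 0} → H := fun i => ((‖M (e i)‖⁻¹ : ℝ) : ℂ) • M (e i) with hdef
  have hMh : ∀ i : {i // M (e i) ≠ 0}, M (e i) = (‖M (e i)‖ : ℂ) • h i := fun i =>
    eq_norm_smul_normalize _
  have hbd : ∑ i, (⟪h i, (X ^ a) (h i)⟫_ℂ).re ≤ (trace (X ^ a)).toReal := by
    have h1 := sum_le_trace (s := Finset.univ) hh (isPositive_rpow X a)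
    rw [← ENNReal.ofReal_sum_of_nonneg
      (fun i _ => re_inner_nonneg (isPositive_rpow X a) (h i))] at h1
    exact (ENNReal.ofReal_le_iff_le_toReal htr).1 h1
  rw [sum_eq_sum_subtype_ne_zero (g := fun i => M (e i)) (fun i hi => by simp [hi]),
    sum_eq_sum_subtype_ne_zero (g := fun i => M (e i)) (F := fun i => (‖M (e i)‖ ^ 2) ^ b)
      (fun i hi => by simp [hi, hab.symm.ne_zero])]
  calc ∑ i : {i // M (e i) ≠ 0}, (⟪M (e i), X (M (e i))⟫_ℂ).re
      = ∑ i : {i // M (e i) ≠ 0}, ‖M (e i)‖ ^ 2 * (⟪h i, X (h i)⟫_ℂ).re := by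
        refine Finset.sum_congr rfl fun i _ => ?_
        conv_lhs => rw [hMh i]
        rw [map_smul, inner_smul_left, inner_smul_right, Complex.conj_ofReal,
          Complex.re_ofReal_mul, Complex.re_ofReal_mul]
        ring
    _ ≤ ∑ i : {i // M (e i) ≠ 0},
        ((⟪h i, (X ^ a) (h i)⟫_ℂ).re / a + (‖M (e i)‖ ^ 2) ^ b / b) := by
        refine Finset.sum_le_sum fun i _ => ?_
        have := mul_re_inner_le_rpow hX hab (sq_nonneg ‖M (e i)‖) (h i)
        rwa [hh.1 i, one_pow, mul_one] at this
    _ ≤ _ := by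
        rw [Finset.sum_add_distrib, ← Finset.sum_div, ← Finset.sum_div]
        have := hab.pos
        gcongr

/-- Compressions to finite dimensional subspaces increasing to a space that reduces `X` converge
strongly. -/
theorem tendsto_compression {ι : Type*} [Preorder ι] (U : ι → Submodule ℂ H)
    [∀ i, (U i).HasOrthogonalProjection] [(⨆ i, U i).topologicalClosure.HasOrthogonalProjection]
    (hU : Monotone U) {X : H →L[ℂ] H} (hX : IsSelfAdjoint X)
    (hker : ∀ x ∈ (⨆ i, U i)ᗮ, X x = 0) (x : H) :
    Tendsto (fun i => ((U i).starProjection ∘L X ∘L (U i).starProjection) x) atTop (𝓝 (X x)) := by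
  have hlim := Submodule.starProjection_tendsto_closure_iSup U hU
  set P := (⨆ i, U i).topologicalClosure.starProjection
  have hsym : ∀ x y : H, ⟪X x, y⟫_ℂ = ⟪x, X y⟫_ℂ := hX.isSymmetric
  have hXP : ∀ x, X (P x) = X x := by
    intro x
    have h := hker (x - P x) (by
      rw [← Submodule.orthogonal_closure]
      exact Submodule.sub_starProjection_mem_orthogonal x)
    rw [map_sub, sub_eq_zero] at h
    exact h.symm
  have hPX : ∀ x, P (X x) = X x := by
    intro x
    refine ext_inner_left ℂ fun y => ?_
    rw [← Submodule.inner_starProjection_left_eq_right, ← hsym, hXP, hsym]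
  have h1 : Tendsto (fun i => (U i).starProjection (X ((U i).starProjection x) - X x)) atTop
      (𝓝 0) := by
    have h2 : Tendsto (fun i => ‖X ((U i).starProjection x) - X x‖) atTop (𝓝 0) := by
      rw [← tendsto_iff_norm_sub_tendsto_zero]
      have := (X.continuous.tendsto _).comp (hlim x)
      rwa [hXP] at this
    exact squeeze_zero_norm (fun i => (U i).norm_starProjection_apply_le _) h2
  have h3 := h1.add (hlim (X x))
  rw [zero_add, hPX] at h3
  refine h3.congr fun i => ?_
  simp

/-- The trace of a power of the compression of `X` to a finite dimensional subspace, in an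
eigenbasis `e` of the compression. -/
theorem trace_compression_rpow {U : Submodule ℂ H} [U.HasOrthogonalProjection] {ι : Type*}
    [Fintype ι] {X : H →L[ℂ] H} (hX : X.IsPositive) {e : OrthonormalBasis ι ℂ U}
    (he : Pairwise fun i j => ⟪(e i : H), X (e j)⟫_ℂ = 0) {s : ℝ} (hs : 0 < s) :
    trace ((U.starProjection ∘L X ∘L U.starProjection) ^ s)
      = ENNReal.ofReal (∑ i, (⟪(e i : H), X (e i)⟫_ℂ).re ^ s) := by
  have hP : ∀ y, U.starProjection y = ∑ i, ⟪(e i : H), y⟫_ℂ • (e i : H) := by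
    intro y
    rw [Submodule.starProjection_apply, e.orthogonalProjectionOnto_apply_eq_sum]
    simp
  have hreal : ∀ y, ⟪y, X y⟫_ℂ = ((⟪y, X y⟫_ℂ).re : ℂ) := by
    intro y
    rw [eq_comm, ← Complex.conj_eq_iff_re, inner_conj_symm]
    exact hX.isSelfAdjoint.isSymmetric y y
  have hx0 : ∀ i, 0 ≤ (⟪(e i : H), X (e i)⟫_ℂ).re := fun i => re_inner_nonneg hX _
  have hn : ∀ i, ‖(e i : H)‖ = 1 := fun i => e.norm_eq_one i
  have hnorm : ∀ i, ‖((√(⟪(e i : H), X (e i)⟫_ℂ).re : ℝ) : ℂ) • (e i : H)‖ ^ 2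
      = (⟪(e i : H), X (e i)⟫_ℂ).re := by
    intro i
    rw [norm_smul, hn, mul_one, Complex.norm_real, Real.norm_eq_abs, sq_abs, Real.sq_sqrt (hx0 i)]
  rw [trace_rpow_eq_sum_norm
    (g := fun i => ((√(⟪(e i : H), X (e i)⟫_ℂ).re : ℝ) : ℂ) • (e i : H)) ?_
    (hX.conj_starProjection U) ?_ hs]
  · simp only [hnorm]
  · intro i j hij
    have : ⟪(e i : H), (e j : H)⟫_ℂ = 0 := e.orthonormal.2 hij
    rw [inner_smul_left, inner_smul_right, this, mul_zero, mul_zero]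
  · intro y
    change U.starProjection (X (U.starProjection y)) = _
    rw [hP]
    refine Finset.sum_congr rfl fun i _ => ?_
    have h1 : ⟪(e i : H), X (U.starProjection y)⟫_ℂ
        = ⟪(e i : H), y⟫_ℂ * ⟪(e i : H), X (e i)⟫_ℂ := by
      rw [hP, map_sum, inner_sum, Finset.sum_eq_single i (fun j _ hji => by
        rw [map_smul, inner_smul_right, he hji.symm, mul_zero])
        (fun h => absurd (Finset.mem_univ i) h), map_smul, inner_smul_right]
    rw [h1, inner_smul_left, smul_smul, Complex.conj_ofReal, mul_right_comm, ← Complex.ofReal_mul,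
      Real.mul_self_sqrt (hx0 i), ← hreal, mul_comm]

/-- Subadditivity of `tr X^a`, `X = σ^(-p/2) ρ σ^(-p/2)`, for `a > 1`. By lower semicontinuity it
suffices to bound the compressions of `X` to finite dimensional subspaces of `range σ^(p/2)`. On such
a subspace the supremum in
`tr X^a = sup_L {a tr (L* ρ L) - (a - 1) tr (L* σ^p L)^(1/p)}`
is attained: `σ^(p/2) L` has to be the power `(a - 1) / 2` of the compression. For fixed `L` the
expression is subadditive in `(ρ, σ)` by Epstein's theorem. -/
theorem trace_rpow_le_add {p a : ℝ} (hp0 : 0 < p) (hp1 : p < 1) (hab : a.HolderConjugate p⁻¹)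
    {ρ₁ ρ₂ σ₁ σ₂ X X₁ X₂ : H →L[ℂ] H} (hσ₁ : σ₁.IsPositive) (hσ₂ : σ₂.IsPositive)
    (hX : IsNegSandwich (p / 2) (ρ₁ + ρ₂) (σ₁ + σ₂) X) (hX₁ : IsNegSandwich (p / 2) ρ₁ σ₁ X₁)
    (hX₂ : IsNegSandwich (p / 2) ρ₂ σ₂ X₂) :
    trace (X ^ a) ≤ trace (X₁ ^ a) + trace (X₂ ^ a) := by
  rcases eq_or_ne (trace (X₁ ^ a)) ∞ with ht₁ | ht₁
  · simp [ht₁]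
  rcases eq_or_ne (trace (X₂ ^ a)) ∞ with ht₂ | ht₂
  · simp [ht₂]
  have hp2 : 0 < p / 2 := half_pos hp0
  have hσ := hσ₁.add hσ₂
  have hform : ∀ {ρ σ X : H →L[ℂ] H}, IsNegSandwich (p / 2) ρ σ X → ∀ x,
      (⟪x, ρ x⟫_ℂ).re = (⟪(σ ^ (p / 2)) x, X ((σ ^ (p / 2)) x)⟫_ℂ).re := by
    intro ρ σ X h x
    rw [inner_rpow_left, ← mul_apply_eq_comp, ← mul_apply_eq_comp, h.2.2]
  set S : H →L[ℂ] H := (σ₁ + σ₂) ^ (p / 2) with hS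
  let U : Finset H → Submodule ℂ H := fun F => (Submodule.span ℂ (F : Set H)).map S.toLinearMap
  have hUmono : Monotone U := fun F G h =>
    Submodule.map_mono (Submodule.span_mono (by exact_mod_cast h))
  have hUfin : ∀ F, FiniteDimensional ℂ (U F) := fun F => by
    have : FiniteDimensional ℂ (Submodule.span ℂ (F : Set H)) :=
      FiniteDimensional.span_finset ℂ F
    infer_instance
  have : CompleteSpace (⨆ F, U F).topologicalClosure :=
    (Submodule.isClosed_topologicalClosure _).completeSpace_coe
  have hker : ∀ x ∈ (⨆ F, U F)ᗮ, X x = 0 := by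
    intro x hx
    refine hX.2.1 x (rpow_apply_eq_zero hσ hp2 (by linarith) ?_)
    refine ext_inner_left ℂ fun y => ?_
    rw [inner_zero_right, ← inner_rpow_left]
    refine hx _ (Submodule.mem_iSup_of_mem {y} ⟨y, Submodule.subset_span (by simp), rfl⟩)
  refine trace_rpow_le_of_tendsto (l := atTop) (fun F => hX.1.conj_starProjection (U F)) hX.1
    (fun F => norm_compression_le (U F) X)
    (tendsto_compression U hUmono hX.1.isSelfAdjoint hker) hab.pos fun F => ?_
  -- `X^(1/2)` restricted to `U F` has a singular basis, an eigenbasis of the compression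
  obtain ⟨e, he⟩ := exists_isSingularBasis ((X ^ (1 / 2 : ℝ)).toLinearMap ∘ₗ (U F).subtype)
  have he' : Pairwise fun i j => ⟪(e i : H), X (e j)⟫_ℂ = 0 := fun i j hij =>
    (inner_rpow_half hX.1 _ _).symm.trans (he hij)
  rw [trace_compression_rpow hX.1 he' hab.pos]
  have hpre : ∀ i, ∃ l, S l = e i := fun i => by
    obtain ⟨l, -, hl⟩ := (e i).2
    exact ⟨l, hl⟩
  choose l hl using hpre
  set x : Fin (Module.finrank ℂ (U F)) → ℝ := fun i => (⟪(e i : H), X (e i)⟫_ℂ).re with hx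
  have hx0 : ∀ i, 0 ≤ x i := fun i => re_inner_nonneg hX.1 _
  let L : U F →ₗ[ℂ] H := e.toBasis.constr ℂ fun i => ((x i ^ ((a - 1) / 2) : ℝ) : ℂ) • l i
  have hL : ∀ i, L (e i) = ((x i ^ ((a - 1) / 2) : ℝ) : ℂ) • l i := fun i => by
    simpa only [e.coe_toBasis] using e.toBasis.constr_basis ℂ _ i
  have hSL : ∀ i, S (L (e i)) = ((x i ^ ((a - 1) / 2) : ℝ) : ℂ) • (e i : H) := fun i => by
    rw [hL, map_smul, hl]
  have hsing : IsSingularBasis (S.toLinearMap ∘ₗ L) e := fun i j hij => by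
    have h0 : ⟪(e i : H), (e j : H)⟫_ℂ = 0 := e.orthonormal.2 hij
    simp only [LinearMap.comp_apply, ContinuousLinearMap.coe_coe]
    rw [hSL, hSL, inner_smul_left, inner_smul_right, h0, mul_zero, mul_zero]
  have ha1 : 0 < a - 1 := sub_pos.2 hab.lt
  have hexp : (a - 1) * p⁻¹ = a := by
    have := hab.sub_one_mul_conj
    exact this
  have hsq : ∀ i, (x i ^ ((a - 1) / 2)) ^ 2 = x i ^ (a - 1) := fun i => by
    rw [← Real.rpow_mul_natCast (hx0 i)]
    congr 1
    push_cast
    ring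
  have hE : ∑ i, (‖S (L (e i))‖ ^ 2) ^ p⁻¹ = ∑ i, x i ^ a := by
    refine Finset.sum_congr rfl fun i _ => ?_
    have hn : ‖(e i : H)‖ = 1 := e.norm_eq_one i
    rw [hSL, norm_smul, hn, mul_one, Complex.norm_real, Real.norm_eq_abs, sq_abs, hsq,
      ← Real.rpow_mul (hx0 i), hexp]
  have hρ : ∑ i, (⟪L (e i), (ρ₁ + ρ₂) (L (e i))⟫_ℂ).re = ∑ i, x i ^ a := by
    refine Finset.sum_congr rfl fun i _ => ?_
    rw [hform hX, hSL, map_smul, inner_smul_left, inner_smul_right, Complex.conj_ofReal,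
      Complex.re_ofReal_mul, Complex.re_ofReal_mul, ← mul_assoc, ← sq, hsq]
    change x i ^ (a - 1) * x i = x i ^ a
    rw [← Real.rpow_add_one' (hx0 i) (by simpa using hab.ne_zero), sub_add_cancel]
  obtain ⟨e₁, he₁⟩ := exists_isSingularBasis ((σ₁ ^ (p / 2)).toLinearMap ∘ₗ L)
  obtain ⟨e₂, he₂⟩ := exists_isSingularBasis ((σ₂ ^ (p / 2)).toLinearMap ∘ₗ L)
  have hep := sum_norm_rpow_superadditive (e := e₁) (e' := e₂) hσ₁ hσ₂ hp0 hp1.le L hsing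
  have hy₁ := sum_re_inner_le_trace_rpow hX₁.1 hab ht₁ he₁
  have hy₂ := sum_re_inner_le_trace_rpow hX₂.1 hab ht₂ he₂
  simp only [LinearMap.comp_apply, ContinuousLinearMap.coe_coe, ← hform hX₁, ← hform hX₂]
    at hy₁ hy₂
  rw [sum_re_inner_apply_eq e₁ e] at hy₁
  rw [sum_re_inner_apply_eq e₂ e] at hy₂
  rw [← hS, hE] at hep
  simp only [add_apply, inner_add_right, Complex.add_re, Finset.sum_add_distrib] at hρ
  rw [← ENNReal.ofReal_toReal ht₁, ← ENNReal.ofReal_toReal ht₂,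
    ← ENNReal.ofReal_add ENNReal.toReal_nonneg ENNReal.toReal_nonneg]
  refine ENNReal.ofReal_le_ofReal ?_
  have hinv : a⁻¹ + p = 1 := by simpa using hab.inv_add_inv_eq_one
  have ha0 := hab.pos
  simp only [div_inv_eq_mul] at hy₁ hy₂
  have hfin : (∑ i, x i ^ a) * a⁻¹
      ≤ ((trace (X₁ ^ a)).toReal + (trace (X₂ ^ a)).toReal) * a⁻¹ := by
    rw [div_eq_mul_inv] at hy₁ hy₂
    have := mul_le_mul_of_nonneg_right hep hp0.le
    have h5 : a⁻¹ = 1 - p := by linarith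
    rw [h5] at hy₁ hy₂ ⊢
    nlinarith
  exact le_of_mul_le_mul_right hfin (inv_pos.2 ha0)

theorem trace_smul {c : ℝ} (hc : 0 ≤ c) (T : H →L[ℂ] H) :
    trace ((c : ℂ) • T) = ENNReal.ofReal c * trace T := by
  simp only [trace, diagSum, smul_apply, inner_smul_right, Complex.re_ofReal_mul,
    ENNReal.ofReal_mul hc, ENNReal.tsum_mul_left]

theorem sandwichedTrace_eq_of_isNegSandwich {a : ℝ} (ha : 1 < a) {ρ σ X : H →L[ℂ] H}
    (hσ : σ.IsPositive) (hX : IsNegSandwich ((a - 1) / (2 * a)) ρ σ X) :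
    sandwichedTrace a ρ σ = trace (X ^ a) := by
  have h0 : 0 < (a - 1) / (2 * a) := div_pos (by linarith) (by linarith)
  have h1 : (a - 1) / (2 * a) < 1 := by
    rw [div_lt_one (by linarith)]
    linarith
  rw [sandwichedTrace, if_neg ha.not_ge]
  exact le_antisymm (iInf₂_le X hX) (le_iInf₂ fun Y hY => by rw [hX.unique h0 h1 hσ hY])

theorem sandwichedTrace_eq_top {a : ℝ} (ha : 1 < a) {ρ σ : H →L[ℂ] H}
    (h : ¬∃ X, IsNegSandwich ((a - 1) / (2 * a)) ρ σ X) : sandwichedTrace a ρ σ = ∞ := by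
  rw [sandwichedTrace, if_neg ha.not_ge]
  exact iInf₂_eq_top.2 fun X hX => absurd ⟨X, hX⟩ h

theorem sandwichedTrace_add_le {a : ℝ} (ha : 1 < a) {ρ₁ ρ₂ σ₁ σ₂ : H →L[ℂ] H}
    (hρ₁ : ρ₁.IsPositive) (hρ₂ : ρ₂.IsPositive) (hσ₁ : σ₁.IsPositive) (hσ₂ : σ₂.IsPositive) :
    sandwichedTrace a (ρ₁ + ρ₂) (σ₁ + σ₂)
      ≤ sandwichedTrace a ρ₁ σ₁ + sandwichedTrace a ρ₂ σ₂ := by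
  by_cases h₁ : ∃ X, IsNegSandwich ((a - 1) / (2 * a)) ρ₁ σ₁ X
  swap
  · simp [sandwichedTrace_eq_top ha h₁]
  by_cases h₂ : ∃ X, IsNegSandwich ((a - 1) / (2 * a)) ρ₂ σ₂ X
  swap
  · simp [sandwichedTrace_eq_top ha h₂]
  obtain ⟨X₁, hX₁⟩ := h₁
  obtain ⟨X₂, hX₂⟩ := h₂
  have hσ := hσ₁.add hσ₂
  have ha0 : 0 < a := by linarith
  obtain ⟨p, hp⟩ : ∃ p, p = (a - 1) / a := ⟨_, rfl⟩
  have hpe : (a - 1) / (2 * a) = p / 2 := by rw [hp, div_div, mul_comm a]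
  have hp0 : 0 < p := hp ▸ div_pos (by linarith) ha0
  have hp1 : p < 1 := by rw [hp, div_lt_one ha0]; linarith
  have hab : a.HolderConjugate p⁻¹ := by
    rw [Real.holderConjugate_iff]
    refine ⟨ha, ?_⟩
    rw [inv_inv, hp]
    field_simp
    ring
  -- `ρᵢ ≤ ‖Xᵢ‖ σᵢ^p ≤ ‖Xᵢ‖ (σ₁ + σ₂)^p` by operator monotonicity
  have hle : ∀ {ρ σ X : H →L[ℂ] H}, IsNegSandwich ((a - 1) / (2 * a)) ρ σ X → σ ≤ σ₁ + σ₂ →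
      ∀ x, (⟪x, ρ x⟫_ℂ).re ≤ ‖X‖ * (⟪x, ((σ₁ + σ₂) ^ p) x⟫_ℂ).re := by
    intro ρ σ X h hs x
    calc (⟪x, ρ x⟫_ℂ).re = (⟪(σ ^ (p / 2)) x, X ((σ ^ (p / 2)) x)⟫_ℂ).re := by
          rw [inner_rpow_left, ← mul_apply_eq_comp, ← mul_apply_eq_comp, ← hpe, h.2.2]
      _ ≤ ‖(σ ^ (p / 2)) x‖ * (‖X‖ * ‖(σ ^ (p / 2)) x‖) :=
          (Complex.re_le_norm _).trans ((norm_inner_le_norm _ _).trans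
            (by gcongr; exact X.le_opNorm _))
      _ = ‖X‖ * (⟪x, (σ ^ p) x⟫_ℂ).re := by
          have := norm_sq_rpow_apply σ (half_pos hp0) x
          rw [mul_div_cancel₀ p two_ne_zero] at this
          rw [← this]
          ring
      _ ≤ _ := mul_le_mul_of_nonneg_left
          (re_inner_mono (CFC.rpow_le_rpow ⟨hp0.le, hp1.le⟩ hs) x) (norm_nonneg _)
  obtain ⟨X, hX⟩ := exists_isNegSandwich (β := p / 2) (c := ‖X₁‖ + ‖X₂‖) (half_pos hp0)
    (hρ₁.add hρ₂) hσ (by positivity) (fun x => by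
      rw [mul_div_cancel₀ p two_ne_zero, add_mul, add_apply, inner_add_right, Complex.add_re]
      exact add_le_add
        (hle hX₁ (le_add_of_nonneg_right (nonneg_of_isPositive hσ₂)) x)
        (hle hX₂ (le_add_of_nonneg_left (nonneg_of_isPositive hσ₁)) x))
  rw [sandwichedTrace_eq_of_isNegSandwich ha hσ₁ hX₁,
    sandwichedTrace_eq_of_isNegSandwich ha hσ₂ hX₂,
    sandwichedTrace_eq_of_isNegSandwich ha hσ (hpe ▸ hX)]
  exact trace_rpow_le_add hp0 hp1 hab hσ₁ hσ₂ hX (hpe ▸ hX₁) (hpe ▸ hX₂)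

theorem sandwichedTrace_smul_le {a : ℝ} (ha : 1 < a) {c : ℝ} (hc : 0 < c) {ρ σ : H →L[ℂ] H}
    (hσ : σ.IsPositive) :
    sandwichedTrace a ((c : ℂ) • ρ) ((c : ℂ) • σ) ≤ ENNReal.ofReal c * sandwichedTrace a ρ σ := by
  by_cases h : ∃ X, IsNegSandwich ((a - 1) / (2 * a)) ρ σ X
  swap
  · rw [sandwichedTrace_eq_top ha h, ENNReal.mul_top (by simpa using hc)]
    exact le_top
  obtain ⟨X, hX⟩ := h
  have ha0 : 0 < a := by linarith
  have h0 : 0 < (a - 1) / (2 * a) := div_pos (by linarith) (by linarith)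
  have hcσ : ((c : ℂ) • σ).IsPositive := hσ.smul_of_nonneg (by exact_mod_cast hc.le)
  have hd : 0 ≤ c ^ a⁻¹ := Real.rpow_nonneg hc.le _
  have hX' : IsNegSandwich ((a - 1) / (2 * a)) ((c : ℂ) • ρ) ((c : ℂ) • σ)
      (((c ^ a⁻¹ : ℝ) : ℂ) • X) := by
    refine ⟨hX.1.smul_of_nonneg (by exact_mod_cast hd), fun x hx => ?_, ?_⟩
    · rw [smul_apply, hX.2.1 x, smul_zero]
      rw [smul_apply, smul_eq_zero] at hx
      exact hx.resolve_left (by exact_mod_cast hc.ne')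
    · rw [smul_rpow_of_nonneg hσ hc.le h0.le]
      simp only [smul_mul_assoc, mul_smul_comm, smul_smul]
      rw [hX.2.2, ← Complex.ofReal_mul, ← Complex.ofReal_mul, ← Real.rpow_add hc,
        ← Real.rpow_add hc]
      have : (a - 1) / (2 * a) + (a⁻¹ + (a - 1) / (2 * a)) = 1 := by field_simp; ring
      rw [this, Real.rpow_one]
  rw [sandwichedTrace_eq_of_isNegSandwich ha hσ hX,
    sandwichedTrace_eq_of_isNegSandwich ha hcσ hX', smul_rpow_of_nonneg hX.1 hd ha0.le,
    Real.rpow_inv_rpow hc.le ha0.ne', trace_smul hc.le]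

end Convex

/-! ### Joint concavity for `1 / 2 ≤ α < 1` -/

section Concave

variable {H W V : Type*} [NormedAddCommGroup H] [InnerProductSpace ℂ H]
  [NormedAddCommGroup W] [InnerProductSpace ℂ W] [NormedAddCommGroup V] [InnerProductSpace ℂ V]

/-- Jensen's inequality for the power `r ≥ 1` and weights of total mass at most one. -/
theorem rpow_sum_le_sum_mul_rpow {ι : Type*} (s : Finset ι) {q x : ι → ℝ} (hq : ∀ i, 0 ≤ q i)
    (hx : ∀ i, 0 ≤ x i) (hq1 : ∑ i ∈ s, q i ≤ 1) {r : ℝ} (hr : 1 ≤ r) :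
    (∑ i ∈ s, q i * x i) ^ r ≤ ∑ i ∈ s, q i * x i ^ r := by
  have hr0 : 0 < r := by linarith
  have hs : 0 ≤ ∑ i ∈ s, q i * x i ^ r :=
    Finset.sum_nonneg fun i _ => mul_nonneg (hq i) (Real.rpow_nonneg (hx i) _)
  have h := Real.inner_le_weight_mul_Lp_of_nonneg s hr q x hq hx
  have h1 : (∑ i ∈ s, q i) ^ (1 - r⁻¹) ≤ 1 :=
    Real.rpow_le_one (Finset.sum_nonneg fun i _ => hq i) hq1
      (sub_nonneg.2 (inv_le_one_of_one_le₀ hr))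
  have h2 := h.trans (mul_le_of_le_one_left (Real.rpow_nonneg hs _) h1)
  have h3 := Real.rpow_le_rpow
    (Finset.sum_nonneg fun i _ => mul_nonneg (hq i) (hx i)) h2 hr0.le
  rwa [Real.rpow_inv_rpow hs hr0.ne'] at h3

/-- For `w` orthonormal, `r ≥ 1` and a singular basis `g` of `G`,
`∑ᵢ ⟪wᵢ, G G* wᵢ⟫ ^ r ≤ tr (G G*) ^ r = tr (G* G) ^ r`. -/
theorem sum_rpow_sum_norm_inner_sq_le {ι κ : Type*} [Fintype ι] [Fintype κ] {w : ι → H}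
    (hw : Orthonormal ℂ w) {G : W →ₗ[ℂ] H} {g : OrthonormalBasis κ ℂ W} (hg : IsSingularBasis G g)
    {r : ℝ} (hr : 1 ≤ r) :
    ∑ i, (∑ k, ‖⟪w i, G (g k)⟫_ℂ‖ ^ 2) ^ r ≤ ∑ k, (‖G (g k)‖ ^ 2) ^ r := by
  classical
  have hr0 : r ≠ 0 := by linarith
  have hh := orthonormal_normalize hg
  set h : {k // G (g k) ≠ 0} → H := fun k => ((‖G (g k)‖⁻¹ : ℝ) : ℂ) • G (g k) with hdef
  have hGh : ∀ k : {k // G (g k) ≠ 0}, G (g k) = (‖G (g k)‖ : ℂ) • h k := fun k =>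
    eq_norm_smul_normalize _
  have hinner : ∀ i, ∑ k, ‖⟪w i, G (g k)⟫_ℂ‖ ^ 2
      = ∑ k, ‖⟪h k, w i⟫_ℂ‖ ^ 2 * ‖G (g k)‖ ^ 2 := by
    intro i
    rw [sum_eq_sum_subtype_ne_zero (g := fun k => G (g k)) (fun k hk => by simp [hk])]
    refine Finset.sum_congr rfl fun k _ => ?_
    conv_lhs => rw [hGh k]
    rw [inner_smul_right, norm_mul, Complex.norm_real, norm_norm, mul_pow, norm_inner_symm,
      mul_comm]
  rw [sum_eq_sum_subtype_ne_zero (g := fun k => G (g k)) (F := fun k => (‖G (g k)‖ ^ 2) ^ r)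
    (fun k hk => by simp [hk, hr0])]
  calc ∑ i, (∑ k, ‖⟪w i, G (g k)⟫_ℂ‖ ^ 2) ^ r
      ≤ ∑ i, ∑ k : {k // G (g k) ≠ 0}, ‖⟪h k, w i⟫_ℂ‖ ^ 2 * (‖G (g k)‖ ^ 2) ^ r := by
        refine Finset.sum_le_sum fun i _ => ?_
        rw [hinner]
        refine rpow_sum_le_sum_mul_rpow _ (fun k => sq_nonneg _) (fun k => sq_nonneg _) ?_ hr
        have := hh.sum_inner_products_le (w i) (s := Finset.univ)
        rwa [hw.1 i, one_pow] at this
    _ ≤ ∑ k : {k // G (g k) ≠ 0}, (‖G (g k)‖ ^ 2) ^ r := by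
        rw [Finset.sum_comm]
        refine Finset.sum_le_sum fun k _ => ?_
        rw [← Finset.sum_mul]
        refine mul_le_of_le_one_left (by positivity) ?_
        have := hw.sum_inner_products_le (h k) (s := Finset.univ)
        rw [hh.1 k, one_pow] at this
        simpa only [norm_inner_symm] using this

/-- The Hölder–Young inequality `tr |G D|^(2a) ≤ a tr |D|^2 + (1 - a) tr |G|^(2a/(1-a))`. -/
theorem sum_norm_comp_rpow_le {a : ℝ} (ha : 1 / 2 ≤ a) (ha1 : a < 1) {ι κ : Type*} [Fintype ι]
    [Fintype κ] {D : V →ₗ[ℂ] W} {G : W →ₗ[ℂ] H} {u : OrthonormalBasis ι ℂ V}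
    {g : OrthonormalBasis κ ℂ W} (hu : IsSingularBasis (G ∘ₗ D) u) (hg : IsSingularBasis G g) :
    ∑ i, (‖G (D (u i))‖ ^ 2) ^ a
      ≤ a * ∑ i, ‖D (u i)‖ ^ 2 + (1 - a) * ∑ k, (‖G (g k)‖ ^ 2) ^ (a / (1 - a)) := by
  classical
  have ha0 : 0 < a := by linarith
  have hb0 : 0 < 1 - a := by linarith
  have hr : 1 ≤ a / (1 - a) := by rw [le_div_iff₀ hb0]; linarith
  have hw := orthonormal_normalize hu
  set w : {i // (G ∘ₗ D) (u i) ≠ 0} → H :=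
    fun i => ((‖(G ∘ₗ D) (u i)‖⁻¹ : ℝ) : ℂ) • (G ∘ₗ D) (u i) with hdef
  have hterm : ∀ i : {i // (G ∘ₗ D) (u i) ≠ 0}, (‖G (D (u i))‖ ^ 2) ^ a
      ≤ a * ‖D (u i)‖ ^ 2 + (1 - a) * (∑ k, ‖⟪w i, G (g k)⟫_ℂ‖ ^ 2) ^ (a / (1 - a)) := by
    intro i
    set t := ∑ k, ‖⟪w i, G (g k)⟫_ℂ‖ ^ 2 with ht
    have ht0 : 0 ≤ t := Finset.sum_nonneg fun k _ => sq_nonneg _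
    have hn : ‖G (D (u i))‖ ≠ 0 := norm_ne_zero_iff.2 i.2
    -- `‖G D uᵢ‖ = ⟪wᵢ, G D uᵢ⟫ = ⟪G* wᵢ, D uᵢ⟫`
    have h1 : ‖G (D (u i))‖ ≤ √t * ‖D (u i)‖ := by
      have h2 : ⟪w i, G (D (u i))⟫_ℂ = (‖G (D (u i))‖ : ℂ) := by
        simp only [hdef, LinearMap.comp_apply]
        rw [inner_smul_left, Complex.conj_ofReal, inner_self_eq_norm_sq_to_K]
        have : (‖G (D (u i))‖ : ℂ) ≠ 0 := by exact_mod_cast hn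
        push_cast
        field_simp
        rfl
      have h3 : ⟪w i, G (D (u i))⟫_ℂ = ∑ k, ⟪g k, D (u i)⟫_ℂ * ⟪w i, G (g k)⟫_ℂ := by
        conv_lhs => rw [← g.sum_repr' (D (u i)), map_sum, inner_sum]
        simp only [map_smul, inner_smul_right]
      calc ‖G (D (u i))‖ = ‖⟪w i, G (D (u i))⟫_ℂ‖ := by rw [h2]; simp
        _ ≤ ∑ k, ‖⟪w i, G (g k)⟫_ℂ‖ * ‖⟪g k, D (u i)⟫_ℂ‖ := by
            rw [h3]
            refine (norm_sum_le _ _).trans_eq (Finset.sum_congr rfl fun k _ => ?_)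
            rw [norm_mul, mul_comm]
        _ ≤ √t * √(∑ k, ‖⟪g k, D (u i)⟫_ℂ‖ ^ 2) := Real.sum_mul_le_sqrt_mul_sqrt _ _ _
        _ = _ := by rw [g.sum_sq_norm_inner_right, Real.sqrt_sq (norm_nonneg _)]
    have h2 : ‖G (D (u i))‖ ^ 2 ≤ ‖D (u i)‖ ^ 2 * t := by
      calc _ ≤ (√t * ‖D (u i)‖) ^ 2 := by gcongr
        _ = _ := by rw [mul_pow, Real.sq_sqrt ht0, mul_comm]
    refine (Real.rpow_le_rpow (sq_nonneg _) h2 ha0.le).trans ?_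
    have h4 := Real.geom_mean_le_arith_mean2_weighted ha0.le hb0.le (sq_nonneg ‖D (u i)‖)
      (Real.rpow_nonneg ht0 (a / (1 - a))) (by ring)
    rwa [← Real.rpow_mul ht0, div_mul_cancel₀ a hb0.ne',
      ← Real.mul_rpow (sq_nonneg _) ht0] at h4
  have hsum := sum_rpow_sum_norm_inner_sq_le hw hg hr
  have hsub : ∑ i, (‖G (D (u i))‖ ^ 2) ^ a
      = ∑ i : {i // (G ∘ₗ D) (u i) ≠ 0}, (‖G (D (u i))‖ ^ 2) ^ a := by
    refine sum_eq_sum_subtype_ne_zero (g := fun i => (G ∘ₗ D) (u i)) fun i hi => ?_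
    rw [LinearMap.comp_apply] at hi
    simp [hi, ha0.ne']
  have hD : ∑ i : {i // (G ∘ₗ D) (u i) ≠ 0}, ‖D (u i)‖ ^ 2 ≤ ∑ i, ‖D (u i)‖ ^ 2 := by
    rw [← Finset.sum_subtype (Finset.univ.filter fun i => (G ∘ₗ D) (u i) ≠ 0) (by simp)
      (fun i => ‖D (u i)‖ ^ 2)]
    exact Finset.sum_le_sum_of_subset_of_nonneg (Finset.filter_subset _ _)
      fun i _ _ => sq_nonneg _
  calc _ = _ := hsub
    _ ≤ _ := Finset.sum_le_sum fun i _ => hterm i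
    _ = a * ∑ i : {i // (G ∘ₗ D) (u i) ≠ 0}, ‖D (u i)‖ ^ 2 + (1 - a) *
          ∑ i : {i // (G ∘ₗ D) (u i) ≠ 0}, (∑ k, ‖⟪w i, G (g k)⟫_ℂ‖ ^ 2) ^ (a / (1 - a)) := by
        rw [Finset.sum_add_distrib, Finset.mul_sum, Finset.mul_sum]
    _ ≤ _ := by gcongr

variable [CompleteSpace H]

/-- Superadditivity for operators `ρᵢ = Nᵢ Nᵢ*` of finite rank, in terms of the singular values of
`σᵢ^(p/2) Nᵢ`. With `N = (N₁, N₂)`, so that `N N* = ρ₁ + ρ₂`, the variational upper bound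
`sum_norm_comp_rpow_le` is applied to `σᵢ^(p/2) Nᵢ = (σᵢ^(p/2) K) (C ιᵢ)`, where `N = K C` is the
factorization that is optimal for `ρ₁ + ρ₂` and `σ₁ + σ₂`, up to a small `δ > 0` which makes `C`
invertible. -/
theorem sum_norm_rpow_add_le {a p : ℝ} (ha : 1 / 2 ≤ a) (ha1 : a < 1) (hp : p = (1 - a) / a)
    [FiniteDimensional ℂ W] [FiniteDimensional ℂ V] {σ₁ σ₂ : H →L[ℂ] H} (hσ₁ : σ₁.IsPositive)
    (hσ₂ : σ₂.IsPositive) {N₁ : W →ₗ[ℂ] H} {N₂ : V →ₗ[ℂ] H} {N : WithLp 2 (W × V) →ₗ[ℂ] H}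
    (hN : ∀ x, N x = N₁ x.fst + N₂ x.snd)
    {ι κ ν : Type*} [Fintype ι] [Fintype κ] [Fintype ν] {u₁ : OrthonormalBasis ι ℂ W}
    {u₂ : OrthonormalBasis κ ℂ V} {u : OrthonormalBasis ν ℂ (WithLp 2 (W × V))}
    (hu₁ : IsSingularBasis ((σ₁ ^ (p / 2)).toLinearMap ∘ₗ N₁) u₁)
    (hu₂ : IsSingularBasis ((σ₂ ^ (p / 2)).toLinearMap ∘ₗ N₂) u₂)
    (hu : IsSingularBasis (((σ₁ + σ₂) ^ (p / 2)).toLinearMap ∘ₗ N) u) :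
    ∑ i, (‖(σ₁ ^ (p / 2)) (N₁ (u₁ i))‖ ^ 2) ^ a + ∑ i, (‖(σ₂ ^ (p / 2)) (N₂ (u₂ i))‖ ^ 2) ^ a
      ≤ ∑ j, (‖((σ₁ + σ₂) ^ (p / 2)) (N (u j))‖ ^ 2) ^ a := by
  have ha0 : 0 < a := by linarith
  have hb0 : 0 < 1 - a := by linarith
  have hp0 : 0 < p := hp ▸ div_pos hb0 ha0
  have hp1 : p ≤ 1 := by rw [hp, div_le_one ha0]; linarith
  have hpi : a / (1 - a) = p⁻¹ := by rw [hp, inv_div]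
  set S : H →L[ℂ] H := (σ₁ + σ₂) ^ (p / 2) with hS
  set x : ν → ℝ := fun j => ‖S (N (u j))‖ ^ 2 with hx
  have hx0 : ∀ j, 0 ≤ x j := fun j => sq_nonneg _
  have key : ∀ δ : ℝ, 0 < δ →
      ∑ i, (‖(σ₁ ^ (p / 2)) (N₁ (u₁ i))‖ ^ 2) ^ a + ∑ i, (‖(σ₂ ^ (p / 2)) (N₂ (u₂ i))‖ ^ 2) ^ a
        ≤ a * ∑ j, (x j + δ) ^ a + (1 - a) * ∑ j, x j ^ a := by
    intro δ hδ
    have hxδ : ∀ j, 0 < x j + δ := fun j => add_pos_of_nonneg_of_pos (hx0 j) hδ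
    set c : ν → ℝ := fun j => (x j + δ) ^ (a / 2) with hc
    have hc0 : ∀ j, 0 < c j := fun j => Real.rpow_pos_of_pos (hxδ j) _
    have hcsq : ∀ j, c j ^ 2 = (x j + δ) ^ a := fun j => by
      rw [hc, ← Real.rpow_mul_natCast (hxδ j).le]
      congr 1
      push_cast
      ring
    let C : WithLp 2 (W × V) →ₗ[ℂ] WithLp 2 (W × V) := u.toBasis.constr ℂ fun j => (c j : ℂ) • u j
    let K : WithLp 2 (W × V) →ₗ[ℂ] H :=
      u.toBasis.constr ℂ fun j => (((c j)⁻¹ : ℝ) : ℂ) • N (u j)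
    have hC : ∀ j, C (u j) = (c j : ℂ) • u j := fun j => by
      simpa only [u.coe_toBasis] using u.toBasis.constr_basis ℂ _ j
    have hK : ∀ j, K (u j) = (((c j)⁻¹ : ℝ) : ℂ) • N (u j) := fun j => by
      simpa only [u.coe_toBasis] using u.toBasis.constr_basis ℂ _ j
    have hKC : ∀ y, K (C y) = N y := by
      have : K ∘ₗ C = N := by
        refine u.toBasis.ext fun j => ?_
        have : (c j : ℂ) ≠ 0 := by exact_mod_cast (hc0 j).ne'
        rw [u.coe_toBasis, LinearMap.comp_apply, hC, map_smul, hK, smul_smul, Complex.ofReal_inv,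
          mul_inv_cancel₀ this, one_smul]
      exact fun y => congrArg (fun T : WithLp 2 (W × V) →ₗ[ℂ] H => T y) this
    have hCu : IsSingularBasis C u := fun i j hij => by
      simp only
      rw [hC, hC, inner_smul_left, inner_smul_right, u.orthonormal.2 hij, mul_zero, mul_zero]
    have hKu : IsSingularBasis (S.toLinearMap ∘ₗ K) u := fun i j hij => by
      have h0 := hu hij
      simp only [LinearMap.comp_apply, ContinuousLinearMap.coe_coe] at h0 ⊢
      rw [hK, hK, map_smul, map_smul, inner_smul_left, inner_smul_right, h0, mul_zero, mul_zero]
    let ι₁ : W →ₗ[ℂ] WithLp 2 (W × V) :=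
      (WithLp.linearEquiv 2 ℂ (W × V)).symm.toLinearMap ∘ₗ LinearMap.inl ℂ W V
    let ι₂ : V →ₗ[ℂ] WithLp 2 (W × V) :=
      (WithLp.linearEquiv 2 ℂ (W × V)).symm.toLinearMap ∘ₗ LinearMap.inr ℂ W V
    have hKι₁ : ∀ y, K (C (ι₁ y)) = N₁ y := fun y => by
      rw [hKC, hN]; simp [ι₁]
    have hKι₂ : ∀ y, K (C (ι₂ y)) = N₂ y := fun y => by
      rw [hKC, hN]; simp [ι₂]
    obtain ⟨g₁, hg₁⟩ := exists_isSingularBasis ((σ₁ ^ (p / 2)).toLinearMap ∘ₗ K)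
    obtain ⟨g₂, hg₂⟩ := exists_isSingularBasis ((σ₂ ^ (p / 2)).toLinearMap ∘ₗ K)
    have h₁ := sum_norm_comp_rpow_le (D := C ∘ₗ ι₁) (u := u₁) ha ha1
      (fun i j hij => by simpa [hKι₁] using hu₁ hij) hg₁
    have h₂ := sum_norm_comp_rpow_le (D := C ∘ₗ ι₂) (u := u₂) ha ha1
      (fun i j hij => by simpa [hKι₂] using hu₂ hij) hg₂
    have hep := sum_norm_rpow_superadditive (e := g₁) (e' := g₂) hσ₁ hσ₂ hp0 hp1 K hKu
    simp only [LinearMap.comp_apply, ContinuousLinearMap.coe_coe, hKι₁, hKι₂, hpi] at h₁ h₂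
    have hsq : ∑ i, ‖C (ι₁ (u₁ i))‖ ^ 2 + ∑ i, ‖C (ι₂ (u₂ i))‖ ^ 2 = ∑ j, (x j + δ) ^ a := by
      have e₁ : ∀ j i, ‖⟪u j, ι₁ (u₁ i)⟫_ℂ‖ = ‖⟪(u j).fst, u₁ i⟫_ℂ‖ := fun j i => by
        simp [ι₁, WithLp.prod_inner_apply]
      have e₂ : ∀ j i, ‖⟪u j, ι₂ (u₂ i)⟫_ℂ‖ = ‖⟪(u j).snd, u₂ i⟫_ℂ‖ := fun j i => by
        simp [ι₂, WithLp.prod_inner_apply]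
      have hCj : ∀ j, ‖C (u j)‖ ^ 2 = c j ^ 2 := fun j => by
        rw [hC, norm_smul, u.norm_eq_one, mul_one, Complex.norm_real, Real.norm_eq_abs, sq_abs]
      simp only [hCu.norm_sq (ι₁ _), hCu.norm_sq (ι₂ _), e₁, e₂, hCj]
      rw [Finset.sum_comm, Finset.sum_comm (f := fun i j => c j ^ 2 * ‖⟪(u j).snd, u₂ i⟫_ℂ‖ ^ 2)]
      simp only [← Finset.mul_sum, u₁.sum_sq_norm_inner_left, u₂.sum_sq_norm_inner_left]
      rw [← Finset.sum_add_distrib]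
      refine Finset.sum_congr rfl fun j _ => ?_
      rw [← mul_add, ← WithLp.prod_norm_sq_eq_of_L2, u.norm_eq_one, one_pow, mul_one, hcsq]
    have hle : ∑ j, (‖S (K (u j))‖ ^ 2) ^ p⁻¹ ≤ ∑ j, x j ^ a := by
      refine Finset.sum_le_sum fun j _ => ?_
      have h1 : ‖S (K (u j))‖ ^ 2 ≤ x j ^ (1 - a) := by
        rw [hK, map_smul, norm_smul, mul_pow, Complex.norm_real, norm_inv, Real.norm_eq_abs,
          abs_of_pos (hc0 j), inv_pow, hcsq, inv_mul_le_iff₀ (Real.rpow_pos_of_pos (hxδ j) a)]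
        calc x j = x j ^ a * x j ^ (1 - a) := by
              rw [← Real.rpow_add' (hx0 j) (by simp), add_sub_cancel, Real.rpow_one]
          _ ≤ _ := by
              gcongr
              linarith
      calc _ ≤ (x j ^ (1 - a)) ^ p⁻¹ :=
            Real.rpow_le_rpow (sq_nonneg _) h1 (inv_pos.2 hp0).le
        _ = x j ^ a := by
            rw [← Real.rpow_mul (hx0 j), ← hpi, mul_div_cancel₀ a hb0.ne']
    rw [← hsq]
    have := mul_le_mul_of_nonneg_left (hep.trans hle) hb0.le
    linarith
  have hlim : Tendsto (fun δ : ℝ => a * ∑ j, (x j + δ) ^ a + (1 - a) * ∑ j, x j ^ a) (𝓝[>] 0)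
      (𝓝 (a * ∑ j, (x j + 0) ^ a + (1 - a) * ∑ j, x j ^ a)) := by
    have hcont : Continuous fun δ : ℝ => a * ∑ j, (x j + δ) ^ a + (1 - a) * ∑ j, x j ^ a := by
      refine (continuous_const.mul (continuous_finsetSum _ fun j _ => ?_)).add continuous_const
      exact (Real.continuous_rpow_const ha0.le).comp (continuous_const.add continuous_id)
    exact (hcont.tendsto 0).mono_left nhdsWithin_le_nhds
  have h := ge_of_tendsto hlim (eventually_nhdsWithin_of_forall key)
  simp only [add_zero] at h
  linarith

/-- The trace of a power of `M M*`, where `M` has finite dimensional domain and adjoint `M'`. -/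
theorem trace_rpow_eq_of_adjoint {ι : Type*} [Fintype ι] {M : W →ₗ[ℂ] H} {M' : H → W}
    (hM : ∀ w y, ⟪M w, y⟫_ℂ = ⟪w, M' y⟫_ℂ) {u : OrthonormalBasis ι ℂ W} (hu : IsSingularBasis M u)
    {T : H →L[ℂ] H} (hT : T.IsPositive) (hTM : ∀ y, T y = M (M' y)) {s : ℝ} (hs : 0 < s) :
    trace (T ^ s) = ENNReal.ofReal (∑ i, (‖M (u i)‖ ^ 2) ^ s) := by
  refine trace_rpow_eq_sum_norm hu hT (fun y => ?_) hs
  simp only [hTM, hM]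
  conv_lhs => rw [← u.sum_repr' (M' y), map_sum]
  simp only [map_smul]

theorem isPositive_conj {S T : H →L[ℂ] H} (hS : IsSelfAdjoint S) (hT : T.IsPositive) :
    (S * T * S).IsPositive :=
  (ContinuousLinearMap.nonneg_iff_isPositive _).1 (hS.conjugate_nonneg (nonneg_of_isPositive hT))

theorem isSelfAdjoint_rpow (A : H →L[ℂ] H) (s : ℝ) : IsSelfAdjoint (A ^ s) :=
  (isPositive_rpow A s).isSelfAdjoint

theorem isPositive_starProjection (U : Submodule ℂ H) [U.HasOrthogonalProjection] :
    U.starProjection.IsPositive :=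
  (ContinuousLinearMap.nonneg_iff_isPositive _).1 isStarProjection_starProjection.nonneg

theorem conj_starProjection_le {ρ : H →L[ℂ] H} (hρ : ρ.IsPositive) (U : Submodule ℂ H)
    [U.HasOrthogonalProjection] :
    ρ ^ (1 / 2 : ℝ) * U.starProjection * ρ ^ (1 / 2 : ℝ) ≤ ρ := by
  have h := (isSelfAdjoint_rpow ρ (1 / 2)).conjugate_le_conjugate
    (isStarProjection_starProjection (U := U)).le_one
  rwa [mul_one, rpow_half_mul_self hρ] at h

/-- Truncating `ρ` to the finite rank operators `ρ^(1/2) P ρ^(1/2)` suffices to bound the trace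
functional, by lower semicontinuity of the trace of a power. -/
theorem trace_sandwich_rpow_le {ρ S : H →L[ℂ] H} (hρ : ρ.IsPositive) (hS : IsSelfAdjoint S)
    {a : ℝ} (ha : 0 < a) {B : ℝ≥0∞}
    (hB : ∀ F : Finset H, trace ((S * (ρ ^ (1 / 2 : ℝ) *
      (Submodule.span ℂ (F : Set H)).starProjection * ρ ^ (1 / 2 : ℝ)) * S) ^ a) ≤ B) :
    trace ((S * ρ * S) ^ a) ≤ B := by
  set R : H →L[ℂ] H := ρ ^ (1 / 2 : ℝ) with hR
  let U : Finset H → Submodule ℂ H := fun F => Submodule.span ℂ (F : Set H)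
  have hU : Monotone U := fun F G h => Submodule.span_mono (by exact_mod_cast h)
  have hUfin : ∀ F, FiniteDimensional ℂ (U F) := fun F => FiniteDimensional.span_finset ℂ F
  have htop : ⊤ ≤ (⨆ F, U F).topologicalClosure := fun x _ =>
    Submodule.le_topologicalClosure _
      (Submodule.mem_iSup_of_mem {x} (Submodule.subset_span (by simp)))
  refine trace_rpow_le_of_tendsto (l := atTop) (C := ‖S‖ * (‖R‖ * 1 * ‖R‖) * ‖S‖)
    (fun F => isPositive_conj hS (isPositive_conj (isSelfAdjoint_rpow ρ _)
      (isPositive_starProjection (U F)))) (isPositive_conj hS hρ) (fun F => ?_) (fun x => ?_) ha hB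
  · refine (norm_mul_le _ _).trans (mul_le_mul_of_nonneg_right ?_ (norm_nonneg _))
    refine (norm_mul_le _ _).trans (mul_le_mul_of_nonneg_left ?_ (norm_nonneg _))
    refine (norm_mul_le _ _).trans (mul_le_mul_of_nonneg_right ?_ (norm_nonneg _))
    refine (norm_mul_le _ _).trans (mul_le_mul_of_nonneg_left ?_ (norm_nonneg _))
    exact (U F).starProjection_norm_le
  · have h := ((S * R).continuous.tendsto _).comp
      (Submodule.starProjection_tendsto_self U hU (R (S x)) htop)
    have e : (S * ρ * S) x = (S * R) (R (S x)) := by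
      rw [← rpow_half_mul_self hρ]
      rfl
    rw [e]
    exact h

theorem le_sandwichedTrace_add {a : ℝ} (ha : 1 / 2 ≤ a) (ha1 : a < 1)
    {ρ₁ ρ₂ σ₁ σ₂ : H →L[ℂ] H} (hρ₁ : ρ₁.IsPositive) (hρ₂ : ρ₂.IsPositive)
    (hσ₁ : σ₁.IsPositive) (hσ₂ : σ₂.IsPositive) :
    sandwichedTrace a ρ₁ σ₁ + sandwichedTrace a ρ₂ σ₂
      ≤ sandwichedTrace a (ρ₁ + ρ₂) (σ₁ + σ₂) := by
  have ha0 : 0 < a := by linarith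
  obtain ⟨p, hp⟩ : ∃ p, p = (1 - a) / a := ⟨_, rfl⟩
  have hpe : (1 - a) / (2 * a) = p / 2 := by rw [hp, div_div, mul_comm a]
  simp only [sandwichedTrace, if_pos ha1.le, hpe]
  set S₁ : H →L[ℂ] H := σ₁ ^ (p / 2) with hS₁
  set S₂ : H →L[ℂ] H := σ₂ ^ (p / 2) with hS₂
  set S : H →L[ℂ] H := (σ₁ + σ₂) ^ (p / 2) with hS
  set R₁ : H →L[ℂ] H := ρ₁ ^ (1 / 2 : ℝ) with hR₁
  set R₂ : H →L[ℂ] H := ρ₂ ^ (1 / 2 : ℝ) with hR₂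
  set Q := trace ((S * (ρ₁ + ρ₂) * S) ^ a)
  let U : Finset H → Submodule ℂ H := fun F => Submodule.span ℂ (F : Set H)
  have hUfin : ∀ F, FiniteDimensional ℂ (U F) := fun F => FiniteDimensional.span_finset ℂ F
  let T₁ : Finset H → H →L[ℂ] H := fun F => S₁ * (R₁ * (U F).starProjection * R₁) * S₁
  let T₂ : Finset H → H →L[ℂ] H := fun G => S₂ * (R₂ * (U G).starProjection * R₂) * S₂
  have hproj : ∀ (F : Finset H) (w : U F) (y : H),
      ⟪(w : H), y⟫_ℂ = ⟪w, (U F).orthogonalProjectionOnto y⟫_ℂ := fun F w y =>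
    (Submodule.inner_orthogonalProjectionOnto_eq_of_mem_left w y).symm
  -- the finite rank estimate, and finiteness of the second summand
  have hfin : ∀ F G, trace (T₂ G ^ a) ≠ ∞ ∧ trace (T₁ F ^ a) + trace (T₂ G ^ a) ≤ Q := by
    intro F G
    let N₁ : U F →ₗ[ℂ] H := R₁.toLinearMap ∘ₗ (U F).subtype
    let N₂ : U G →ₗ[ℂ] H := R₂.toLinearMap ∘ₗ (U G).subtype
    let N : WithLp 2 (U F × U G) →ₗ[ℂ] H :=
      (N₁.coprod N₂) ∘ₗ (WithLp.linearEquiv 2 ℂ (U F × U G)).toLinearMap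
    obtain ⟨u₁, hu₁⟩ := exists_isSingularBasis (S₁.toLinearMap ∘ₗ N₁)
    obtain ⟨u₂, hu₂⟩ := exists_isSingularBasis (S₂.toLinearMap ∘ₗ N₂)
    obtain ⟨u, hu⟩ := exists_isSingularBasis (S.toLinearMap ∘ₗ N)
    have h := sum_norm_rpow_add_le (N := N) ha ha1 hp hσ₁ hσ₂ (fun x => rfl) hu₁ hu₂ hu
    have e₁ : trace (T₁ F ^ a) = ENNReal.ofReal (∑ i, (‖S₁ (N₁ (u₁ i))‖ ^ 2) ^ a) :=
      trace_rpow_eq_of_adjoint (M' := fun y => (U F).orthogonalProjectionOnto (R₁ (S₁ y)))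
        (fun w y => by
          rw [← hproj, hS₁, hR₁, ← inner_rpow_left, ← inner_rpow_left]; rfl) hu₁
        (isPositive_conj (isSelfAdjoint_rpow _ _) (isPositive_conj (isSelfAdjoint_rpow _ _)
          (isPositive_starProjection _))) (fun y => rfl) ha0
    have e₂ : trace (T₂ G ^ a) = ENNReal.ofReal (∑ i, (‖S₂ (N₂ (u₂ i))‖ ^ 2) ^ a) :=
      trace_rpow_eq_of_adjoint (M' := fun y => (U G).orthogonalProjectionOnto (R₂ (S₂ y)))
        (fun w y => by
          rw [← hproj, hS₂, hR₂, ← inner_rpow_left, ← inner_rpow_left]; rfl) hu₂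
        (isPositive_conj (isSelfAdjoint_rpow _ _) (isPositive_conj (isSelfAdjoint_rpow _ _)
          (isPositive_starProjection _))) (fun y => rfl) ha0
    have e : trace ((S * (R₁ * (U F).starProjection * R₁ + R₂ * (U G).starProjection * R₂) * S) ^ a)
        = ENNReal.ofReal (∑ j, (‖S (N (u j))‖ ^ 2) ^ a) :=
      trace_rpow_eq_of_adjoint
        (M' := fun y => WithLp.toLp 2 ((U F).orthogonalProjectionOnto (R₁ (S y)),
          (U G).orthogonalProjectionOnto (R₂ (S y))))
        (fun w y => by
          rw [WithLp.prod_inner_apply]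
          change _ = ⟪w.fst, (U F).orthogonalProjectionOnto (R₁ (S y))⟫_ℂ
            + ⟪w.snd, (U G).orthogonalProjectionOnto (R₂ (S y))⟫_ℂ
          rw [← hproj, ← hproj, hR₁, hR₂, ← inner_rpow_left ρ₁, ← inner_rpow_left ρ₂,
            ← inner_add_left, hS, ← inner_rpow_left]
          rfl) hu
        (isPositive_conj (isSelfAdjoint_rpow _ _)
          ((isPositive_conj (isSelfAdjoint_rpow _ _) (isPositive_starProjection _)).add
            (isPositive_conj (isSelfAdjoint_rpow _ _) (isPositive_starProjection _))))
        (fun y => rfl) ha0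
    refine ⟨e₂ ▸ ENNReal.ofReal_ne_top, ?_⟩
    calc trace (T₁ F ^ a) + trace (T₂ G ^ a)
        ≤ ENNReal.ofReal (∑ j, (‖S (N (u j))‖ ^ 2) ^ a) := by
          rw [e₁, e₂, ← ENNReal.ofReal_add (Finset.sum_nonneg fun i _ => by positivity)
            (Finset.sum_nonneg fun i _ => by positivity)]
          exact ENNReal.ofReal_le_ofReal h
      _ ≤ Q := by
          rw [← e]
          exact trace_mono (CFC.rpow_le_rpow ⟨ha0.le, ha1.le⟩
            ((isSelfAdjoint_rpow _ _).conjugate_le_conjugate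
              (add_le_add (conj_starProjection_le hρ₁ _) (conj_starProjection_le hρ₂ _))))
  -- the two truncations are removed one after the other
  have h₁ : ∀ G, trace ((S₁ * ρ₁ * S₁) ^ a) + trace (T₂ G ^ a) ≤ Q := by
    intro G
    refine add_le_of_le_tsub_right_of_le (le_add_self.trans (hfin ∅ G).2) ?_
    exact trace_sandwich_rpow_le hρ₁ (isSelfAdjoint_rpow _ _) ha0 fun F =>
      ENNReal.le_sub_of_add_le_right (hfin F G).1 (hfin F G).2
  rcases eq_or_ne (trace ((S₁ * ρ₁ * S₁) ^ a)) ∞ with ht | ht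
  · have := h₁ ∅
    rw [ht, top_add, top_le_iff] at this
    rw [this]
    exact le_top
  · refine add_le_of_le_tsub_left_of_le (le_self_add.trans (h₁ ∅)) ?_
    exact trace_sandwich_rpow_le hρ₂ (isSelfAdjoint_rpow _ _) ha0 fun G =>
      ENNReal.le_sub_of_add_le_left ht (h₁ G)

theorem sandwichedTrace_smul {a : ℝ} (ha : 1 / 2 ≤ a) (ha1 : a < 1) {c : ℝ} (hc : 0 < c)
    {ρ σ : H →L[ℂ] H} (hρ : ρ.IsPositive) (hσ : σ.IsPositive) :
    sandwichedTrace a ((c : ℂ) • ρ) ((c : ℂ) • σ) = ENNReal.ofReal c * sandwichedTrace a ρ σ := by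
  have ha0 : 0 < a := by linarith
  have hs : 0 ≤ (1 - a) / (2 * a) := div_nonneg (by linarith) (by linarith)
  simp only [sandwichedTrace, if_pos ha1.le]
  rw [smul_rpow_of_nonneg hσ hc.le hs, ← trace_smul hc.le]
  simp only [smul_mul_assoc, mul_smul_comm, smul_smul, ← Complex.ofReal_mul]
  rw [smul_rpow_of_nonneg (isPositive_conj (isSelfAdjoint_rpow _ _) hρ) (by positivity) ha0.le]
  congr 3
  calc (c ^ ((1 - a) / (2 * a)) * (c * c ^ ((1 - a) / (2 * a)))) ^ a
      = (c ^ ((1 - a) / (2 * a)) * c ^ ((1 - a) / (2 * a)) * c ^ (1 : ℝ)) ^ a := by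
        rw [Real.rpow_one]
        ring_nf
    _ = (c ^ a⁻¹) ^ a := by
        rw [← Real.rpow_add hc, ← Real.rpow_add hc]
        congr 2
        field_simp
        ring
    _ = c := Real.rpow_inv_rpow hc.le ha0.ne'

end Concave

section JointConvexity

/-! ### Conclusion from superadditivity and homogeneity -/

variable {H : Type*} [NormedAddCommGroup H] [InnerProductSpace ℂ H]

theorem nnreal_smul_eq (c : ℝ≥0) (A : H →L[ℂ] H) : c • A = ((c : ℝ) : ℂ) • A := rfl

theorem isPositive_nnreal_smul (c : ℝ≥0) {A : H →L[ℂ] H} (hA : A.IsPositive) :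
    (c • A).IsPositive := by
  rw [nnreal_smul_eq]
  exact hA.smul_of_nonneg (by exact_mod_cast c.2)

theorem convex_isPositive_prod :
    Convex ℝ≥0 {p : (H →L[ℂ] H) × (H →L[ℂ] H) | p.1.IsPositive ∧ p.2.IsPositive} :=
  fun _ hx _ hy b c _ _ _ =>
    ⟨(isPositive_nnreal_smul b hx.1).add (isPositive_nnreal_smul c hy.1),
      (isPositive_nnreal_smul b hx.2).add (isPositive_nnreal_smul c hy.2)⟩

variable [CompleteSpace H]

theorem concaveOn_sandwichedTrace {a : ℝ} (ha : 1 / 2 ≤ a) (ha1 : a < 1) :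
    ConcaveOn ℝ≥0 {p : (H →L[ℂ] H) × (H →L[ℂ] H) | p.1.IsPositive ∧ p.2.IsPositive}
      (fun p => sandwichedTrace a p.1 p.2) := by
  have hhom : ∀ (c : ℝ≥0) {ρ σ : H →L[ℂ] H}, ρ.IsPositive → σ.IsPositive →
      c • sandwichedTrace a ρ σ ≤ sandwichedTrace a (c • ρ) (c • σ) := by
    intro c ρ σ hρ hσ
    rcases eq_or_ne c 0 with rfl | hc
    · simp
    · rw [nnreal_smul_eq, nnreal_smul_eq, sandwichedTrace_smul ha ha1 (by positivity) hρ hσ,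
        ENNReal.ofReal_coe_nnreal]
      rfl
  refine ⟨convex_isPositive_prod, ?_⟩
  rintro ⟨ρ₁, σ₁⟩ ⟨hρ₁, hσ₁⟩ ⟨ρ₂, σ₂⟩ ⟨hρ₂, hσ₂⟩ b c - - -
  exact (add_le_add (hhom b hρ₁ hσ₁) (hhom c hρ₂ hσ₂)).trans
    (le_sandwichedTrace_add ha ha1 (isPositive_nnreal_smul b hρ₁) (isPositive_nnreal_smul c hρ₂)
      (isPositive_nnreal_smul b hσ₁) (isPositive_nnreal_smul c hσ₂))

theorem convexOn_sandwichedTrace {a : ℝ} (ha : 1 < a) :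
    ConvexOn ℝ≥0 {p : (H →L[ℂ] H) × (H →L[ℂ] H) | p.1.IsPositive ∧ p.2.IsPositive}
      (fun p => sandwichedTrace a p.1 p.2) := by
  have hhom : ∀ (c : ℝ≥0) {ρ σ : H →L[ℂ] H}, σ.IsPositive →
      sandwichedTrace a (c • ρ) (c • σ) ≤ c • sandwichedTrace a ρ σ := by
    intro c ρ σ hσ
    rcases eq_or_ne c 0 with rfl | hc
    · have h0 : IsNegSandwich ((a - 1) / (2 * a)) (0 : H →L[ℂ] H) 0 0 :=
        ⟨ContinuousLinearMap.isPositive_zero, fun _ _ => rfl, by simp⟩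
      have ht : trace ((0 : H →L[ℂ] H) ^ a) = 0 := by
        have : (0 : H →L[ℂ] H) ^ a = 0 := CFC.zero_rpow (by linarith)
        simp [this, trace, diagSum]
      rw [zero_smul, zero_smul, zero_smul,
        sandwichedTrace_eq_of_isNegSandwich ha ContinuousLinearMap.isPositive_zero h0, ht]
    · rw [nnreal_smul_eq, nnreal_smul_eq]
      refine (sandwichedTrace_smul_le ha (by positivity) hσ).trans_eq ?_
      rw [ENNReal.ofReal_coe_nnreal]
      rfl
  refine ⟨convex_isPositive_prod, ?_⟩
  rintro ⟨ρ₁, σ₁⟩ ⟨hρ₁, hσ₁⟩ ⟨ρ₂, σ₂⟩ ⟨hρ₂, hσ₂⟩ b c - - -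
  exact (sandwichedTrace_add_le ha (isPositive_nnreal_smul b hρ₁) (isPositive_nnreal_smul c hρ₂)
    (isPositive_nnreal_smul b hσ₁) (isPositive_nnreal_smul c hσ₂)).trans
    (add_le_add (hhom b hσ₁) (hhom c hσ₂))

end JointConvexity

end SandwichedRenyi

theorem proposition3 {H : Type*} [NormedAddCommGroup H] [InnerProductSpace ℂ H] [CompleteSpace H]
    (α : ℝ) :
    (1 / 2 ≤ α → α < 1 →
      ConcaveOn ℝ≥0
        {p : (H →L[ℂ] H) × (H →L[ℂ] H) | p.1.IsPositive ∧ p.2.IsPositive}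
        (fun p => SandwichedRenyi.sandwichedTrace α p.1 p.2)) ∧
    (1 < α →
      ConvexOn ℝ≥0
        {p : (H →L[ℂ] H) × (H →L[ℂ] H) | p.1.IsPositive ∧ p.2.IsPositive}
        (fun p => SandwichedRenyi.sandwichedTrace α p.1 p.2)) :=
  ⟨SandwichedRenyi.concaveOn_sandwichedTrace, SandwichedRenyi.convexOn_sandwichedTrace⟩
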